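/- Let $\mathbb D$ be the open unit disk of $\mathbb C$; limits $z\to a$ with $a\in\overline{\mathbb D}$ are taken with $z\in\mathbb D$. Let $v:\mathbb D\to(0,\infty)$ be a continuous radial weight ($v(z)=v(|z|)$) with $\sup_{\mathbb D}v=1$ and $v(z)\to0$ as $|z|\to1$. Let $H^\infty_v$ be the Banach space of analytic functions $f$ on $\mathbb D$ with $\|f\|=\sup_{z\in\mathbb D}|f(z)|v(z)<\infty$, and let $H^0_v$ be its subspace of those $f$ with $|f(z)|v(z)\to0$ as $|z|\to1$. Write $\delta_z$ for the evaluation functional $f\mapsto f(z)$ on $H^\infty_v$ and assume $\int_0^1\|\delta_s\|_{(H^\infty_v)^*}\,ds<\infty$. Let $K:\mathbb D\times\mathbb D\to\mathbb C$ be analytic, with $K(z,\cdot)$ bounded for every $z\in\mathbb D$ and $|K(z,w)|\to\infty$ as $(z,w)\to(1,1)$ in $\mathbb D\times\mathbb D$, and assume that $$I_K(f)(z)=\int_0^1 f(x)K(z,x)\,dx$$ defines a bounded operator $H^\infty_v\to H^\infty_v$. For $t\in(0,1)$ and $z\in\mathbb D$ put $$\varphi_t(z)=\frac{t}{(t-1)z+1},\qquad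 T_t(z)=K(z,\varphi_t(z))\,\frac{\partial}{\partial t}\varphi_t(z).$$ Assume that there is $R_0\in(0,1)$ with $$\int_0^1\ \sup_{z\in\mathbb D,\ |\varphi_t(z)|>R_0}\frac{|T_t(z)|\,v(z)}{v(\varphi_t(z))}\,dt<\infty ,$$ and that $$\int_0^1\ \sup_{z\in\mathbb D,\ |\varphi_t(z)|\le R}|T_t(z)|\,v(z)\,dt<\infty\qquad\text{for every }R\in(0,1)$$ (suprema over empty sets being $0$). Let $g$ be analytic on $\mathbb D$ with $\sup_{\mathbb D}|g|v\le1$, with $\lim_{z\to\zeta}|g(z)|v(z)=0$ for every $\zeta\ne1$ with $|\zeta|=1$, and with $|g(r)|v(r)\to1$ as $r\to1^-$. Assume finally that for every $t\in(0,1)$ $$\lim_{r\to1^-}\frac{g(\varphi_t(r))}{g(r)}=\limsup_{z\to1}\frac{v(z)}{v(\varphi_t(z))}<\infty,\qquad\text{and}\qquad\lim_{z\to1}T_t(z)\ \text{exists and belongs to}\ [0,\infty).\tag{CEVH}$$ Then, for $X=H^\infty_v$ and for $X=H^0_v$, the essential norm $\|I_K\|_{e,X\to H^\infty_v}=\inf\{\|I_K-L\|: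 L:X\to H^\infty_v\text{ bounded, linear and compact}\}$ satisfies $$\|I_K\|_{e,X\to H^\infty_v}=\int_0^1\limsup_{z\to1}\frac{v(z)}{v(\varphi_t(z))}\,|T_t(z)|\,dt ,$$ where, by the second part of (CEVH), the integrand also equals $\limsup_{z\to1}\frac{v(z)}{v(\varphi_t(z))}\cdot\lim_{z\to1}T_t(z)$. In particular the integral is finite. -/

import Mathlib

open Filter Topology Set MeasureTheory
open scoped ENNReal

noncomputable section

/-- The open unit disk of the complex plane. -/
abbrev unitDisk : Set ℂ := Metric.ball (0 : ℂ) 1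

/-- The filter `|z| → 1` with `z` inside the open unit disk. -/
def toBoundary : Filter ℂ := comap (fun z : ℂ => ‖z‖) (𝓝[<] (1 : ℝ))

/-- A continuous, strictly positive, radial weight on the unit disk, which tends to zero on the
boundary and is normalized by `sup v = 1`. Only the values on the disk matter. -/
structure BoundaryWeight where
  toFun : ℂ → ℝ
  continuousOn : ContinuousOn toFun unitDisk
  pos : ∀ z ∈ unitDisk, 0 < toFun z
  radial : ∀ z ∈ unitDisk, toFun z = toFun (‖z‖ : ℂ)
  tendsto_zero : Tendsto toFun toBoundary (𝓝 0)
  normalized : IsLUB (toFun '' unitDisk) 1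

instance : CoeFun BoundaryWeight (fun _ => ℂ → ℝ) := ⟨BoundaryWeight.toFun⟩

/-- The vector space underlying `H^∞_v`: analytic functions `f` on the unit disk with
`sup |f| v < ∞`. A function on the disk is represented by its extension by zero to `ℂ`. -/
def hInfSubmodule (v : BoundaryWeight) : Submodule ℂ (ℂ → ℂ) where
  carrier := {f | DifferentiableOn ℂ f unitDisk ∧ (∀ z, z ∉ unitDisk → f z = 0) ∧
    ∃ C : ℝ, ∀ z ∈ unitDisk, ‖f z‖ * v z ≤ C}
  zero_mem' := ⟨differentiableOn_const 0, fun _ _ => rfl, 0, fun z _ => by simp⟩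
  add_mem' := by
    rintro f g ⟨hf, hf0, C, hC⟩ ⟨hg, hg0, D, hD⟩
    refine ⟨hf.add hg, fun z hz => by simp [hf0 z hz, hg0 z hz], C + D, fun z hz => ?_⟩
    have h := mul_le_mul_of_nonneg_right (norm_add_le (f z) (g z)) (v.pos z hz).le
    have h1 := hC z hz
    have h2 := hD z hz
    simp only [Pi.add_apply]
    linarith [add_mul ‖f z‖ ‖g z‖ (v z)]
  smul_mem' := by
    rintro c f ⟨hf, hf0, C, hC⟩
    refine ⟨hf.const_smul c, fun z hz => by simp [hf0 z hz], ‖c‖ * C, fun z hz => ?_⟩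
    simp only [Pi.smul_apply, norm_smul, mul_assoc]
    exact mul_le_mul_of_nonneg_left (hC z hz) (norm_nonneg c)

/-- The weighted Banach space `H^∞_v` of analytic functions. It is a type of its own, so that it
carries the topology of its norm and not the topology of pointwise convergence. -/
def HInf (v : BoundaryWeight) : Type := ↥(hInfSubmodule v)

namespace HInf

variable {v : BoundaryWeight}

instance : AddCommGroup (HInf v) := inferInstanceAs (AddCommGroup ↥(hInfSubmodule v))

instance : Module ℂ (HInf v) := inferInstanceAs (Module ℂ ↥(hInfSubmodule v))

/-- The underlying function. -/
def toFun (f : HInf v) : ℂ → ℂ := Subtype.val f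

instance : CoeFun (HInf v) (fun _ => ℂ → ℂ) := ⟨toFun⟩

theorem add_apply (f g : HInf v) (z : ℂ) : (f + g) z = f z + g z := rfl

theorem smul_apply (c : ℂ) (f : HInf v) (z : ℂ) : (c • f) z = c * f z := rfl

theorem zero_apply (z : ℂ) : (0 : HInf v) z = 0 := rfl

theorem apply_of_notMem (f : HInf v) {z : ℂ} (hz : z ∉ unitDisk) : f z = 0 := f.2.2.1 z hz

theorem ext_disk {f g : HInf v} (h : ∀ z ∈ unitDisk, f z = g z) : f = g := by
  refine Subtype.ext (funext fun z => ?_)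
  by_cases hz : z ∈ unitDisk
  · exact h z hz
  · exact (f.apply_of_notMem hz).trans (g.apply_of_notMem hz).symm

/-- The norm `‖f‖ = sup_{|z| < 1} |f z| v z`. -/
instance : Norm (HInf v) := ⟨fun f => ⨆ z : unitDisk, ‖f z‖ * v z⟩

theorem norm_def (f : HInf v) : ‖f‖ = ⨆ z : unitDisk, ‖f z‖ * v z := rfl

theorem bddAbove (f : HInf v) : BddAbove (range fun z : unitDisk => ‖f z‖ * v z) := by
  obtain ⟨C, hC⟩ := f.2.2.2
  exact ⟨C, by rintro _ ⟨z, rfl⟩; exact hC z z.2⟩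

instance : Nonempty unitDisk := ⟨⟨0, Metric.mem_ball_self one_pos⟩⟩

theorem le_norm (f : HInf v) {z : ℂ} (hz : z ∈ unitDisk) : ‖f z‖ * v z ≤ ‖f‖ :=
  le_ciSup f.bddAbove (⟨z, hz⟩ : unitDisk)

theorem core (v : BoundaryWeight) : NormedSpace.Core ℂ (HInf v) where
  norm_nonneg f := Real.iSup_nonneg fun z => mul_nonneg (norm_nonneg _) (v.pos z z.2).le
  norm_smul c f := by
    rw [norm_def, norm_def, Real.mul_iSup_of_nonneg (norm_nonneg c)]
    simp only [smul_apply, norm_mul, mul_assoc]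
  norm_triangle f g := by
    refine ciSup_le fun z => ?_
    have h := mul_le_mul_of_nonneg_right (norm_add_le (f z) (g z)) (v.pos z z.2).le
    have h1 := f.le_norm z.2
    have h2 := g.le_norm z.2
    rw [add_apply]
    linarith [add_mul ‖f z‖ ‖g z‖ (v z)]
  norm_eq_zero_iff f := by
    constructor
    · intro h
      refine ext_disk fun z hz => ?_
      have h1 := f.le_norm hz
      rw [h] at h1
      have h2 : ‖f z‖ ≤ 0 := nonpos_of_mul_nonpos_left h1 (v.pos z hz)
      exact norm_le_zero_iff.1 h2
    · rintro rfl
      simp [norm_def, zero_apply]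

instance : NormedAddCommGroup (HInf v) := NormedAddCommGroup.ofCore (core v)

instance : NormedSpace ℂ (HInf v) := NormedSpace.ofCore (core v)

/-- The evaluation functional `δ_z : f ↦ f z` as an element of the dual of `H^∞_v`. -/
def delta (v : BoundaryWeight) (z : ℂ) : HInf v →L[ℂ] ℂ :=
  LinearMap.mkContinuous
    { toFun := fun f => f z
      map_add' := fun f g => add_apply f g z
      map_smul' := fun c f => smul_apply c f z } |(v z)⁻¹| (by
    intro f
    change ‖f z‖ ≤ |(v z)⁻¹| * ‖f‖
    by_cases hz : z ∈ unitDisk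
    · have hv := v.pos z hz
      rw [abs_of_pos (inv_pos.2 hv), inv_mul_eq_div, le_div_iff₀ hv]
      exact f.le_norm hz
    · rw [f.apply_of_notMem hz, norm_zero]
      exact mul_nonneg (abs_nonneg _) (norm_nonneg f))

end HInf

/-- The closed subspace `H^0_v` of those `f` in `H^∞_v` with `|f z| v z → 0` as `|z| → 1`. -/
def HZero (v : BoundaryWeight) : Submodule ℂ (HInf v) where
  carrier := {f | Tendsto (fun z => ‖f z‖ * v z) toBoundary (𝓝 0)}
  zero_mem' := by
    simpa [HInf.zero_apply] using (tendsto_const_nhds : Tendsto (fun _ : ℂ => (0 : ℝ)) toBoundary (𝓝 0))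
  add_mem' := by
    intro f g hf hg
    have hdisk : ∀ᶠ z in toBoundary, z ∈ unitDisk := by
      refine Filter.mem_of_superset (preimage_mem_comap self_mem_nhdsWithin) fun z hz => ?_
      simpa using hz
    have hsum : Tendsto (fun z => ‖f z‖ * v z + ‖g z‖ * v z) toBoundary (𝓝 0) := by
      simpa using Tendsto.add hf hg
    refine squeeze_zero' (hdisk.mono fun z hz => ?_) (hdisk.mono fun z hz => ?_) hsum
    · exact mul_nonneg (norm_nonneg _) (v.pos z hz).le
    · rw [HInf.add_apply, ← add_mul]
      exact mul_le_mul_of_nonneg_right (norm_add_le _ _) (v.pos z hz).le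
  smul_mem' := by
    intro c f hf
    have h := Tendsto.const_mul ‖c‖ hf
    rw [mul_zero] at h
    refine h.congr fun z => ?_
    rw [HInf.smul_apply, norm_mul, mul_assoc]

/-- The essential norm of a bounded operator: its distance to the compact operators. -/
def essNorm {X Y : Type*} [NormedAddCommGroup X] [NormedSpace ℂ X]
    [NormedAddCommGroup Y] [NormedSpace ℂ Y] (T : X →L[ℂ] Y) : ℝ :=
  sInf {r : ℝ | ∃ L : X →L[ℂ] Y, IsCompactOperator L ∧ r = ‖T - L‖}

/-- `φ_t(z) = x_z(t) = t / ((t - 1) z + 1)`. -/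
def phi (t : ℝ) (z : ℂ) : ℂ := (t : ℂ) / (((t : ℂ) - 1) * z + 1)

/-- `T_t(z) = K(z, x_z(t)) x_z'(t)`, the derivative being taken with respect to `t`. -/
def kernelT (K : ℂ → ℂ → ℂ) (t : ℝ) (z : ℂ) : ℂ :=
  K z (phi t z) * deriv (fun s : ℝ => phi s z) t

/-- The standing assumptions on the kernel: analytic on the bidisk, bounded in the second variable,
with `|K(z,w)| → ∞` as `(z,w) → (1,1)` inside the bidisk. -/
structure AdmissibleKernel (K : ℂ → ℂ → ℂ) : Prop where
  analytic : AnalyticOnNhd ℂ (fun p : ℂ × ℂ => K p.1 p.2) (unitDisk ×ˢ unitDisk)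
  bounded : ∀ z ∈ unitDisk, ∃ C : ℝ, ∀ w ∈ unitDisk, ‖K z w‖ ≤ C
  blowup : Tendsto (fun p : ℂ × ℂ => ‖K p.1 p.2‖) (𝓝[unitDisk ×ˢ unitDisk] (1, 1)) atTop

/-- `∫_0^1 sup {|T_t(z)| v(z) / v(φ_t(z)) : |z| < 1, |φ_t(z)| > R₀} dt < ∞` for some
`0 < R₀ < 1`. -/
def CondCUBH (v : BoundaryWeight) (K : ℂ → ℂ → ℂ) : Prop :=
  ∃ R₀ ∈ Ioo (0 : ℝ) 1,
    ∫⁻ t in Ioo (0 : ℝ) 1, ⨆ z ∈ {z : ℂ | z ∈ unitDisk ∧ R₀ < ‖phi t z‖},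
      ENNReal.ofReal (‖kernelT K t z‖ * v z / v (phi t z)) < ∞

/-- `∫_0^1 sup {|T_t(z)| v(z) : |z| < 1, |φ_t(z)| ≤ R} dt < ∞` for all `0 < R < 1`. -/
def CondCUB2H (v : BoundaryWeight) (K : ℂ → ℂ → ℂ) : Prop :=
  ∀ R ∈ Ioo (0 : ℝ) 1,
    ∫⁻ t in Ioo (0 : ℝ) 1, ⨆ z ∈ {z : ℂ | z ∈ unitDisk ∧ ‖phi t z‖ ≤ R},
      ENNReal.ofReal (‖kernelT K t z‖ * v z) < ∞

/-- The assumptions on the auxiliary function: `g` is analytic on the disk, `|g| v ≤ 1`,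
`|g| v → 0` at every boundary point except `1`, and `|g(r)| v(r) → 1` as `r → 1`. -/
structure AdmissibleG (v : BoundaryWeight) (g : ℂ → ℂ) : Prop where
  analytic : DifferentiableOn ℂ g unitDisk
  le_one : ∀ z ∈ unitDisk, ‖g z‖ * v z ≤ 1
  tendsto_zero : ∀ ζ : ℂ, ‖ζ‖ = 1 → ζ ≠ 1 →
    Tendsto (fun z => ‖g z‖ * v z) (𝓝[unitDisk] ζ) (𝓝 0)
  tendsto_one : Tendsto (fun r : ℝ => ‖g (r : ℂ)‖ * v (r : ℂ)) (𝓝[<] 1) (𝓝 1)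

/-- `limsup_{z → 1} v(z) / v(φ_t(z))`, where `z` tends to `1` inside the disk. -/
def limsupRatio (v : BoundaryWeight) (t : ℝ) : ℝ≥0∞ :=
  limsup (fun z => ENNReal.ofReal (v z / v (phi t z))) (𝓝[unitDisk] (1 : ℂ))

/-- The condition for the exact value: for every `t ∈ (0,1)`,
`lim_{r → 1} g(φ_t(r)) / g(r) = limsup_{z → 1} v(z) / v(φ_t(z)) < ∞` and
`lim_{z → 1} T_t(z)` exists and belongs to `[0,∞)`. -/
def CondCEVH (v : BoundaryWeight) (K : ℂ → ℂ → ℂ) (g : ℂ → ℂ) : Prop :=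
  ∀ t ∈ Ioo (0 : ℝ) 1,
    limsupRatio v t < ∞ ∧
    Tendsto (fun r : ℝ => g (phi t (r : ℂ)) / g (r : ℂ)) (𝓝[<] 1)
      (𝓝 (((limsupRatio v t).toReal : ℝ) : ℂ)) ∧
    ∃ τ : ℝ, 0 ≤ τ ∧ Tendsto (fun z => kernelT K t z) (𝓝[unitDisk] (1 : ℂ)) (𝓝 (τ : ℂ))

/-- The bounded operator `I` on `H^∞_v` is the integral operator
`I_K f (z) = ∫_0^1 f(x) K(z,x) dx`. -/
def IsIntegralOperator (v : BoundaryWeight) (K : ℂ → ℂ → ℂ) (I : HInf v →L[ℂ] HInf v) : Prop :=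
  ∀ f : HInf v, ∀ z ∈ unitDisk, I f z = ∫ x in (0 : ℝ)..1, f (x : ℂ) * K z (x : ℂ)

/-- `∫_0^1 limsup_{z → 1} (v(z) / v(φ_t(z))) T_t(z) dt`. The limit superior is taken of the
modulus, which makes no difference when `T_t(z)` has a limit in `[0,∞)` as `z → 1` and the ratio
is bounded near `1`. -/
def limsupIntegral (v : BoundaryWeight) (K : ℂ → ℂ → ℂ) : ℝ≥0∞ :=
  ∫⁻ t in Ioo (0 : ℝ) 1,
    limsup (fun z => ENNReal.ofReal (v z / v (phi t z) * ‖kernelT K t z‖)) (𝓝[unitDisk] (1 : ℂ))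

end

/-!
The curves `t ↦ φ_t(z)` run from `0` to `1`, and an integral of an analytic function along them does
not depend on `z` (`integral_path_eq`): this is clear for dilated curves, and the integrability of the
norms of the evaluation functionals allows the dilation factor to tend to `1`. Therefore
`I_K f (z) = ∫ f(φ_t(z)) T_t(z) dt` (`IsIntegralOperator.apply_eq`), and both essential norms lie
between two bounds which coincide.

*Upper bound.* For every `R < 1` and `ε > 0` there is a compact operator `L` on `H^∞_v` with
`‖id - L‖ ≤ 1 + ε` and `|f - L f| ≤ ε ‖f‖` on `|w| ≤ R` (`HInf.exists_compact_approx_id`). It is an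
average of `N` finite-rank approximations of dilations `f ↦ f(ρ ·)`, the numbers `ρ` being chosen one
after another so that at each point all but one of the approximations are close either to `f`
or to `0`. Comparing `I` with `I ∘ L` bounds the essential norm by the integral over `t` of the
supremum of `|T_t(z)| v(z) / v(φ_t(z))` over `|φ_t(z)| > R` (`essNorm_le_lintegral_outerSup`). As
`R → 1` these sets shrink to the point `1`, and dominated convergence gives the integral of the limit
superior.

*Lower bound.* The functions `f_n(z) = g(z) z ^ n ((1 - z) / 2) ^ (1 / (n + 1))` belong to the unit
ball of `H^0_v` and tend to zero uniformly on compact sets. A gliding hump argument shows that compact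
operators on `H^0_v` map them to a null sequence
(`IsCompactOperator.tendsto_zero_of_locally_null`), so that every `‖I - L‖` with `L` compact is at
least the limit of `|I f_n (r_n)| v(r_n)`, for any `r_n → 1`. For `r_n = 1 - (n + 1)⁻²` the factor
of `g` in `f_n` is close to `1` at `φ_t(r_n)`, and after multiplication by a unimodular constant the
integrand of `I f_n (r_n) v(r_n)` converges to `limsup (v / v ∘ φ_t) · lim T_t ≥ 0`
(`limsupIntegral_le_essNorm`).
-/

/-! ### The weighted space: construction, rotations, maximum principle -/

/-- On a circle inside the disk, an analytic function is at least as large somewhere as at a given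
enclosed point. -/
theorem exists_norm_eq_and_norm_le {f : ℂ → ℂ} (hf : DifferentiableOn ℂ f unitDisk) {u : ℂ} {s : ℝ}
    (hu : ‖u‖ ≤ s) (hs : s < 1) : ∃ w : ℂ, ‖w‖ = s ∧ ‖f u‖ ≤ ‖f w‖ := by
  rcases (norm_nonneg u).trans hu |>.eq_or_lt with rfl | h0
  · exact ⟨u, le_antisymm hu (norm_nonneg u), le_rfl⟩
  have hcl : Metric.closedBall (0 : ℂ) s ⊆ unitDisk := Metric.closedBall_subset_ball hs
  have hd : DiffContOnCl ℂ f (Metric.ball 0 s) := by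
    refine DifferentiableOn.diffContOnCl (hf.mono ?_)
    rwa [closure_ball _ h0.ne']
  obtain ⟨w, hw, hmax⟩ := Complex.exists_mem_frontier_isMaxOn_norm Metric.isBounded_ball
    ⟨0, Metric.mem_ball_self h0⟩ hd
  rw [frontier_ball _ h0.ne', mem_sphere_zero_iff_norm] at hw
  refine ⟨w, hw, hmax ?_⟩
  rw [closure_ball _ h0.ne']
  simpa using hu

theorem eventually_toBoundary_iff {p : ℂ → Prop} :
    (∀ᶠ z in toBoundary, p z) ↔ ∃ R < 1, ∀ z ∈ unitDisk, R < ‖z‖ → p z := by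
  rw [toBoundary, eventually_comap]
  constructor
  · intro h
    obtain ⟨R, hR, h⟩ := (mem_nhdsLT_iff_exists_Ioo_subset).1 h
    exact ⟨R, hR, fun z hz hRz => h ⟨hRz, by simpa using hz⟩ z rfl⟩
  · rintro ⟨R, hR, h⟩
    refine (mem_nhdsLT_iff_exists_Ioo_subset).2 ⟨R, hR, fun s hs z hz => h z ?_ ?_⟩
    · subst hz; simpa using hs.2
    · subst hz; exact hs.1

namespace BoundaryWeight

theorem eq_of_norm_eq (v : BoundaryWeight) {z w : ℂ} (hz : z ∈ unitDisk) (h : ‖z‖ = ‖w‖) :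
    v z = v w := by
  have hw : w ∈ unitDisk := by simpa [← h] using hz
  rw [v.radial z hz, v.radial w hw, h]

theorem le_one (v : BoundaryWeight) {z : ℂ} (hz : z ∈ unitDisk) : v z ≤ 1 :=
  v.normalized.1 ⟨z, hz, rfl⟩

/-- The weight is bounded below on compact subsets of the disk. -/
theorem exists_pos_le (v : BoundaryWeight) {s : ℝ} (hs : s < 1) :
    ∃ m > 0, ∀ z : ℂ, ‖z‖ ≤ s → m ≤ v z := by
  have hcl : Metric.closedBall (0 : ℂ) s ⊆ unitDisk := Metric.closedBall_subset_ball hs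
  rcases (Metric.closedBall (0 : ℂ) s).eq_empty_or_nonempty with h | h
  · refine ⟨1, one_pos, fun z hz => ?_⟩
    have : z ∈ Metric.closedBall (0 : ℂ) s := by simpa using hz
    simp [h] at this
  · obtain ⟨w, hw, hmin⟩ := (isCompact_closedBall (0 : ℂ) s).exists_isMinOn h
      (v.continuousOn.mono hcl)
    exact ⟨v w, v.pos w (hcl hw), fun z hz => hmin (by simpa using hz)⟩

/-- The weight is small close to the boundary. -/
theorem exists_lt_one_forall_le (v : BoundaryWeight) {ε : ℝ} (hε : 0 < ε) :
    ∃ R < 1, ∀ z ∈ unitDisk, R < ‖z‖ → v z ≤ ε :=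
  eventually_toBoundary_iff.1 (v.tendsto_zero.eventually (ge_mem_nhds hε))

end BoundaryWeight

namespace HInf

variable {v : BoundaryWeight}

/-- The element of `H^∞_v` given by an analytic function `f` with `|f| v ≤ C` on the disk; values
outside the disk are replaced by zero. -/
noncomputable def mk (f : ℂ → ℂ) (hf : DifferentiableOn ℂ f unitDisk) (C : ℝ)
    (hC : ∀ z ∈ unitDisk, ‖f z‖ * v z ≤ C) : HInf v :=
  ⟨unitDisk.indicator f, hf.congr fun z hz => indicator_of_mem hz f,
    fun _ hz => indicator_of_notMem hz f, C, fun z hz => by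
      rw [indicator_of_mem hz]; exact hC z hz⟩

theorem mk_apply {f : ℂ → ℂ} {hf : DifferentiableOn ℂ f unitDisk} {C : ℝ}
    {hC : ∀ z ∈ unitDisk, ‖f z‖ * v z ≤ C} {z : ℂ} (hz : z ∈ unitDisk) :
    (mk f hf C hC : HInf v) z = f z := indicator_of_mem hz f

theorem differentiableOn (f : HInf v) : DifferentiableOn ℂ f unitDisk := f.2.1

theorem norm_le {f : HInf v} {C : ℝ} (h : ∀ z ∈ unitDisk, ‖f z‖ * v z ≤ C) : ‖f‖ ≤ C :=
  ciSup_le fun z => h z z.2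

theorem sub_apply (f g : HInf v) (z : ℂ) : (f - g) z = f z - g z := rfl

theorem delta_apply (z : ℂ) (f : HInf v) : delta v z f = f z := rfl

theorem sum_apply {ι : Type*} (s : Finset ι) (f : ι → HInf v) (z : ℂ) :
    (∑ i ∈ s, f i) z = ∑ i ∈ s, f i z := map_sum (delta v z) f s

/-- Since the weight is radial, a bound on `|f| v` passes to dilations of `f`. -/
theorem norm_mul_le_of_norm_le (f : HInf v) {u z : ℂ} (hz : z ∈ unitDisk) (h : ‖u‖ ≤ ‖z‖) :
    ‖f u‖ * v z ≤ ‖f‖ := by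
  have hz' : ‖z‖ < 1 := by simpa using hz
  obtain ⟨w, hw, hle⟩ := exists_norm_eq_and_norm_le f.differentiableOn h hz'
  have hwd : w ∈ unitDisk := by simpa [hw] using hz'
  refine (mul_le_mul_of_nonneg_right hle (v.pos z hz).le).trans ?_
  rw [v.eq_of_norm_eq hz hw.symm]
  exact f.le_norm hwd

/-- The norms of the evaluation functionals are radial and increase with the modulus. -/
theorem norm_apply_le_delta (f : HInf v) {u : ℂ} {s : ℝ} (h : ‖u‖ ≤ s) (hs : s < 1) :
    ‖f u‖ ≤ ‖f‖ * ‖delta v (s : ℂ)‖ := by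
  have hs0 : 0 ≤ s := (norm_nonneg u).trans h
  obtain ⟨w, hw, hle⟩ := exists_norm_eq_and_norm_le f.differentiableOn h hs
  -- a rotation `c` takes the maximum point `w` to the positive real axis
  obtain ⟨c, hc, hcw⟩ : ∃ c : ℂ, ‖c‖ = 1 ∧ c * s = w := by
    rcases hs0.eq_or_lt with h0 | h0
    · exact ⟨1, norm_one, by rw [← h0] at hw ⊢; simp [norm_eq_zero.1 hw]⟩
    · have hs' : (s : ℂ) ≠ 0 := by exact_mod_cast h0.ne'
      exact ⟨w / s, by rw [norm_div, hw, Complex.norm_of_nonneg hs0, div_self h0.ne'],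
        div_mul_cancel₀ _ hs'⟩
  have hmaps : MapsTo (fun z => c * z) unitDisk unitDisk := fun z hz => by
    simpa [hc] using hz
  have hb : ∀ z ∈ unitDisk, ‖f (c * z)‖ * v z ≤ ‖f‖ := fun z hz =>
    f.norm_mul_le_of_norm_le hz (by simp [hc])
  have hsd : (s : ℂ) ∈ unitDisk := by simpa [abs_of_nonneg hs0] using hs
  have h1 := (delta v (s : ℂ)).le_opNorm
    (mk (fun z => f (c * z)) (f.differentiableOn.comp (by fun_prop) hmaps) ‖f‖ hb)
  rw [delta_apply, mk_apply hsd, hcw] at h1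
  refine hle.trans (h1.trans ?_)
  rw [mul_comm]
  gcongr
  exact norm_le fun z hz => by rw [mk_apply hz]; exact hb z hz

/-- Point evaluations are uniformly bounded on compact subsets of the disk. -/
theorem exists_norm_apply_le (v : BoundaryWeight) {s : ℝ} (hs : s < 1) :
    ∃ M > 0, ∀ f : HInf v, ∀ z : ℂ, ‖z‖ ≤ s → ‖f z‖ ≤ M * ‖f‖ := by
  obtain ⟨m, hm, hmv⟩ := v.exists_pos_le hs
  refine ⟨m⁻¹, inv_pos.2 hm, fun f z hz => ?_⟩
  have hzd : z ∈ unitDisk := by simpa using hz.trans_lt hs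
  rw [inv_mul_eq_div, le_div_iff₀ hm]
  exact (mul_le_mul_of_nonneg_left (hmv z hz) (norm_nonneg _)).trans (f.le_norm hzd)

/-! ### Approximation of the identity by finite-rank operators -/

/-- The `n`-th Taylor coefficient at the origin, as a functional on `H^∞_v`. -/
noncomputable def coeff (v : BoundaryWeight) (n : ℕ) : HInf v →L[ℂ] ℂ :=
  LinearMap.mkContinuousOfExistsBound
    { toFun := fun f => (n.factorial : ℂ)⁻¹ * iteratedDeriv n f 0
      map_add' := fun f g => by
        have h0 : unitDisk ∈ 𝓝 (0 : ℂ) := Metric.ball_mem_nhds _ one_pos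
        rw [← mul_add, ← iteratedDeriv_add
          ((f.differentiableOn.analyticAt h0).contDiffAt)
          ((g.differentiableOn.analyticAt h0).contDiffAt)]
        rfl
      map_smul' := fun c f => by
        have : ((c • f : HInf v) : ℂ → ℂ) = fun z => c * f z := rfl
        rw [this, iteratedDeriv_const_mul_field, RingHom.id_apply, smul_eq_mul]
        ring } (by
    obtain ⟨M, hM, h⟩ := exists_norm_apply_le v (s := 1 / 2) (by norm_num)
    refine ⟨M / (1 / 2) ^ n, fun f => ?_⟩
    have hsub : Metric.closedBall (0 : ℂ) (1 / 2) ⊆ unitDisk :=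
      Metric.closedBall_subset_ball (by norm_num)
    have hd : DiffContOnCl ℂ f (Metric.ball 0 (1 / 2)) :=
      DifferentiableOn.diffContOnCl (f.differentiableOn.mono (by
        rwa [closure_ball _ (by norm_num)]))
    have := Complex.norm_iteratedDeriv_le_of_forall_mem_sphere_norm_le n (by norm_num) hd
      (fun z hz => h f z (by simpa using (mem_sphere_zero_iff_norm.1 hz).le))
    have hn : (0 : ℝ) < n.factorial := by positivity
    change ‖(n.factorial : ℂ)⁻¹ * iteratedDeriv n f 0‖ ≤ _
    rw [norm_mul, norm_inv, Complex.norm_natCast, inv_mul_le_iff₀ hn]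
    refine this.trans (le_of_eq ?_)
    ring)

theorem coeff_apply (n : ℕ) (f : HInf v) :
    coeff v n f = (n.factorial : ℂ)⁻¹ * iteratedDeriv n f 0 := rfl

theorem norm_coeff_le {s M : ℝ} (hs0 : 0 < s) (hs : s < 1) {f : HInf v}
    (h : ∀ z : ℂ, ‖z‖ ≤ s → ‖f z‖ ≤ M) (n : ℕ) : ‖coeff v n f‖ ≤ M / s ^ n := by
  have hsub : Metric.closedBall (0 : ℂ) s ⊆ unitDisk := Metric.closedBall_subset_ball hs
  have hd : DiffContOnCl ℂ f (Metric.ball 0 s) :=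
    DifferentiableOn.diffContOnCl (f.differentiableOn.mono (by rwa [closure_ball _ hs0.ne']))
  have := Complex.norm_iteratedDeriv_le_of_forall_mem_sphere_norm_le n hs0 hd
    (fun z hz => h z (mem_sphere_zero_iff_norm.1 hz).le)
  have hn : (0 : ℝ) < n.factorial := by positivity
  rw [coeff_apply, norm_mul, norm_inv, Complex.norm_natCast, inv_mul_le_iff₀ hn]
  exact this.trans (le_of_eq (by ring))

theorem hasSum_coeff (f : HInf v) {z : ℂ} (hz : z ∈ unitDisk) :
    HasSum (fun n => coeff v n f * z ^ n) (f z) := by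
  have := Complex.hasSum_taylorSeries_on_ball f.differentiableOn hz
  simpa [coeff_apply, mul_comm, mul_left_comm, mul_assoc] using this

/-- The monomial `z ^ n` as an element of `H^∞_v`. -/
noncomputable def monomial (v : BoundaryWeight) (n : ℕ) : HInf v :=
  mk (fun z => z ^ n) (by fun_prop) 1 fun z hz => by
    have hz1 : ‖z‖ ≤ 1 := by simpa using (mem_ball_zero_iff.1 hz).le
    rw [norm_pow]
    exact mul_le_one₀ (pow_le_one₀ (norm_nonneg _) hz1) (v.pos z hz).le (v.le_one hz)

theorem _root_.isCompactOperator_smulRight {X Y : Type*} [NormedAddCommGroup X] [NormedSpace ℂ X]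
    [NormedAddCommGroup Y] [NormedSpace ℂ Y] (c : X →L[ℂ] ℂ) (y : Y) :
    IsCompactOperator (c.smulRight y) := by
  have h : IsCompactOperator (ContinuousLinearMap.toSpanSingleton ℂ y) :=
    isCompactOperator_of_locallyCompactSpace_rng _
  exact h.comp_clm c

theorem _root_.isCompactOperator_finset_sum {X Y ι : Type*} [NormedAddCommGroup X] [NormedSpace ℂ X]
    [NormedAddCommGroup Y] [NormedSpace ℂ Y] (s : Finset ι) (L : ι → X →L[ℂ] Y)
    (h : ∀ i ∈ s, IsCompactOperator (L i)) : IsCompactOperator (∑ i ∈ s, L i : X →L[ℂ] Y) := by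
  classical
  induction s using Finset.induction_on with
  | empty => simpa using isCompactOperator_zero
  | insert a s ha ih =>
    rw [Finset.sum_insert ha]
    exact (h a (Finset.mem_insert_self a s)).add
      (ih fun i hi => h i (Finset.mem_insert_of_mem hi))

/-- The dilation `f ↦ f (ρ ·)` is a norm limit of truncated Taylor expansions, which have finite
rank. -/
theorem exists_compact_near_dilation (v : BoundaryWeight) {ρ ε : ℝ} (hρ0 : 0 < ρ) (hρ : ρ < 1)
    (hε : 0 < ε) : ∃ P : HInf v →L[ℂ] HInf v, IsCompactOperator P ∧
      ∀ f : HInf v, ∀ z ∈ unitDisk, ‖P f z - f (ρ * z)‖ ≤ ε * ‖f‖ := by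
  obtain ⟨s, hρs, hs⟩ := exists_between hρ
  have hs0 := hρ0.trans hρs
  obtain ⟨M, hM, hMf⟩ := exists_norm_apply_le v hs
  have hq0 : 0 ≤ ρ / s := by positivity
  have hq : ρ / s < 1 := (div_lt_one hs0).2 hρs
  obtain ⟨m, hm⟩ : ∃ m : ℕ, M * (ρ / s) ^ m / (1 - ρ / s) ≤ ε := by
    have h := ((tendsto_pow_atTop_nhds_zero_of_lt_one hq0 hq).const_mul M).div_const (1 - ρ / s)
    rw [mul_zero, zero_div] at h
    exact (h.eventually (ge_mem_nhds hε)).exists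
  refine ⟨∑ n ∈ Finset.range m, (coeff v n).smulRight (((ρ : ℂ) ^ n) • monomial v n),
    isCompactOperator_finset_sum _ _ fun n _ => isCompactOperator_smulRight _ _, fun f z hz => ?_⟩
  have hz1 : ‖z‖ < 1 := by simpa using hz
  have hρz : (ρ : ℂ) * z ∈ unitDisk := by
    simp only [mem_ball_zero_iff, norm_mul, Complex.norm_of_nonneg hρ0.le]
    nlinarith [norm_nonneg z]
  have h1 : (∑ n ∈ Finset.range m, (coeff v n).smulRight (((ρ : ℂ) ^ n) • monomial v n)) f z
      = ∑ n ∈ Finset.range m, coeff v n f * ((ρ : ℂ) * z) ^ n := by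
    rw [_root_.sum_apply, sum_apply]
    refine Finset.sum_congr rfl fun n _ => ?_
    rw [ContinuousLinearMap.smulRight_apply, smul_apply, smul_apply, monomial, mk_apply hz, mul_pow]
  rw [h1]
  refine (norm_sub_le_of_geometric_bound_of_hasSum (C := M * ‖f‖) hq (fun n => ?_)
    (f.hasSum_coeff hρz) m).trans ?_
  · have h2 := norm_coeff_le hs0 hs (hMf f) n
    have h3 : ‖(ρ : ℂ) * z‖ ^ n ≤ ρ ^ n := by
      refine pow_le_pow_left₀ (norm_nonneg _) ?_ n
      rw [norm_mul, Complex.norm_of_nonneg hρ0.le]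
      exact mul_le_of_le_one_right hρ0.le hz1.le
    rw [norm_mul, norm_pow]
    calc ‖coeff v n f‖ * ‖(ρ : ℂ) * z‖ ^ n ≤ M * ‖f‖ / s ^ n * ρ ^ n := by gcongr
      _ = M * ‖f‖ * (ρ / s) ^ n := by rw [div_pow]; ring
  · calc M * ‖f‖ * (ρ / s) ^ m / (1 - ρ / s) = M * (ρ / s) ^ m / (1 - ρ / s) * ‖f‖ := by ring
      _ ≤ ε * ‖f‖ := by gcongr

/-- Dilations converge to the identity, uniformly on compact subsets and on the unit ball. -/
theorem exists_dilation_near (v : BoundaryWeight) {R ε : ℝ} (hR0 : 0 < R) (hR : R < 1)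
    (hε : 0 < ε) :
    ∃ ρ : ℝ, 0 < ρ ∧ ρ < 1 ∧ ∀ f : HInf v, ∀ z : ℂ, ‖z‖ ≤ R → ‖f z - f (ρ * z)‖ ≤ ε * ‖f‖ := by
  obtain ⟨s, hRs, hs⟩ := exists_between hR
  obtain ⟨M, hM, hMf⟩ := exists_norm_apply_le v hs
  have hd : 0 < s - R := sub_pos.2 hRs
  set D := M / (s - R) with hD
  have hD0 : 0 < D := by positivity
  obtain ⟨δ, hδ0, hδ1, hδ⟩ : ∃ δ : ℝ, 0 < δ ∧ δ < 1 ∧ D * δ ≤ ε := by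
    refine ⟨min (1 / 2) (ε / D), by positivity, (min_le_left _ _).trans_lt (by norm_num), ?_⟩
    calc D * min (1 / 2) (ε / D) ≤ D * (ε / D) := by gcongr; exact min_le_right _ _
      _ = ε := by field_simp
  refine ⟨1 - δ, by linarith, by linarith, fun f z hz => ?_⟩
  have hsub : Metric.closedBall (0 : ℂ) s ⊆ unitDisk := Metric.closedBall_subset_ball hs
  have hdiff : ∀ x ∈ Metric.closedBall (0 : ℂ) R, DifferentiableAt ℂ f x := fun x hx =>
    f.differentiableOn.differentiableAt (Metric.isOpen_ball.mem_nhds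
      (hsub (Metric.closedBall_subset_closedBall hRs.le hx)))
  have hder : ∀ x ∈ Metric.closedBall (0 : ℂ) R, ‖deriv f x‖ ≤ D * ‖f‖ := fun x hx => by
    have hx' : ‖x‖ ≤ R := by simpa using hx
    have hxs : Metric.closedBall x (s - R) ⊆ Metric.closedBall 0 s :=
      Metric.closedBall_subset_closedBall' (by rw [dist_zero_right]; linarith)
    have := Complex.norm_deriv_le_of_forall_mem_sphere_norm_le hd
      (DifferentiableOn.diffContOnCl (f.differentiableOn.mono (by
        rw [closure_ball _ hd.ne']; exact hxs.trans hsub)))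
      (fun y hy => hMf f y (by simpa using hxs (Metric.sphere_subset_closedBall hy)))
    exact this.trans (le_of_eq (by rw [hD]; ring))
  have hρz : ((1 - δ : ℝ) : ℂ) * z ∈ Metric.closedBall (0 : ℂ) R := by
    rw [mem_closedBall_zero_iff, norm_mul, Complex.norm_of_nonneg (by linarith)]
    nlinarith [norm_nonneg z]
  have := (convex_closedBall (0 : ℂ) R).norm_image_sub_le_of_norm_deriv_le hdiff hder hρz
    (by simpa using hz)
  refine this.trans ?_
  have h2 : ‖z - ((1 - δ : ℝ) : ℂ) * z‖ ≤ δ := by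
    have : z - ((1 - δ : ℝ) : ℂ) * z = (δ : ℂ) * z := by push_cast; ring
    rw [this, norm_mul, Complex.norm_of_nonneg hδ0.le]
    nlinarith [norm_nonneg z]
  calc D * ‖f‖ * ‖z - ((1 - δ : ℝ) : ℂ) * z‖ ≤ D * ‖f‖ * δ := by gcongr
    _ = D * δ * ‖f‖ := by ring
    _ ≤ ε * ‖f‖ := by gcongr

/-- A compact operator which is close to the identity on the disk of radius `R`, nearly
contractive, and negligible beyond some larger radius `R'`. -/
theorem exists_compact_near_id (v : BoundaryWeight) {R ε : ℝ} (hR0 : 0 < R) (hR : R < 1)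
    (hε : 0 < ε) : ∃ P : HInf v →L[ℂ] HInf v, IsCompactOperator P ∧
      (∀ f : HInf v, ∀ z : ℂ, ‖z‖ ≤ R → ‖f z - P f z‖ ≤ ε * ‖f‖) ∧
      (∀ f : HInf v, ∀ z ∈ unitDisk, ‖P f z‖ * v z ≤ (1 + ε) * ‖f‖) ∧
      ∃ R' : ℝ, R ≤ R' ∧ R' < 1 ∧
        ∀ f : HInf v, ∀ z ∈ unitDisk, R' < ‖z‖ → ‖P f z‖ * v z ≤ ε * ‖f‖ := by
  have hε2 : 0 < ε / 2 := half_pos hε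
  obtain ⟨ρ, hρ0, hρ, hnear⟩ := exists_dilation_near v hR0 hR hε2
  obtain ⟨P, hPc, hP⟩ := exists_compact_near_dilation v hρ0 hρ hε2
  obtain ⟨M, hM, hMf⟩ := exists_norm_apply_le v hρ
  have hnρ : ∀ z : ℂ, ‖(ρ : ℂ) * z‖ = ρ * ‖z‖ := fun z => by
    rw [norm_mul, Complex.norm_of_nonneg hρ0.le]
  obtain ⟨R', hR'1, hR'⟩ := v.exists_lt_one_forall_le (ε := ε / (M + ε / 2)) (by positivity)
  refine ⟨P, hPc, fun f z hz => ?_, fun f z hz => ?_, max R R', le_max_left _ _,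
    max_lt hR hR'1, fun f z hz hzR => ?_⟩
  · have hzd : z ∈ unitDisk := by simpa using hz.trans_lt hR
    have h1 := hnear f z hz
    have h2 := hP f z hzd
    have h3 : f z - P f z = (f z - f (ρ * z)) - (P f z - f (ρ * z)) := by ring
    rw [h3]
    linarith [norm_sub_le (f z - f (ρ * z)) (P f z - f (ρ * z))]
  · have h1 : ‖P f z‖ ≤ ‖f (ρ * z)‖ + ε / 2 * ‖f‖ := by
      linarith [norm_le_norm_add_norm_sub' (P f z) (f (ρ * z)), hP f z hz]
    have h2 : ‖f (ρ * z)‖ * v z ≤ ‖f‖ := f.norm_mul_le_of_norm_le hz (by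
      rw [hnρ]; exact mul_le_of_le_one_left (norm_nonneg _) hρ.le)
    have h3 := mul_le_mul_of_nonneg_right h1 (v.pos z hz).le
    have h4 : ε / 2 * ‖f‖ * v z ≤ ε / 2 * ‖f‖ :=
      mul_le_of_le_one_right (by positivity) (v.le_one hz)
    nlinarith [mul_nonneg hε.le (norm_nonneg f)]
  · have hz1 : ‖z‖ < 1 := by simpa using hz
    have h1 : ‖P f z‖ ≤ ‖f (ρ * z)‖ + ε / 2 * ‖f‖ := by
      linarith [norm_le_norm_add_norm_sub' (P f z) (f (ρ * z)), hP f z hz]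
    have h2 : ‖f (ρ * z)‖ ≤ M * ‖f‖ := hMf f _ (by
      rw [hnρ]; exact mul_le_of_le_one_right hρ0.le hz1.le)
    have h3 := hR' z hz ((le_max_right _ _).trans_lt hzR)
    calc ‖P f z‖ * v z ≤ ((M + ε / 2) * ‖f‖) * (ε / (M + ε / 2)) := by
          gcongr
          · exact (v.pos z hz).le
          · linarith
      _ = ε * ‖f‖ := by field_simp

/-- A sum of `N` of the operators from `exists_compact_near_id`, each chosen after the radius `R'`
of the preceding one is known: at each point at most one summand is not under control, so the
error exceeds `N` by a bounded amount only. -/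
theorem exists_compact_sum (v : BoundaryWeight) {ε : ℝ} (hε : 0 < ε) (N : ℕ) :
    ∀ R : ℝ, 0 < R → R < 1 → ∃ S : HInf v →L[ℂ] HInf v, IsCompactOperator S ∧
      (∀ f : HInf v, ∀ z ∈ unitDisk, ‖N * f z - S f z‖ * v z ≤ (N + 1 + N * ε) * ‖f‖) ∧
      (∀ f : HInf v, ∀ z : ℂ, ‖z‖ ≤ R → ‖N * f z - S f z‖ ≤ N * ε * ‖f‖) := by
  induction N with
  | zero =>
    refine fun R _ _ => ⟨0, isCompactOperator_zero, fun f z _ => ?_, fun f z _ => ?_⟩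
    · simp [zero_apply]
    · simp [zero_apply]
  | succ N ih =>
    intro R hR0 hR
    obtain ⟨P, hPc, hP1, hP2, R', hRR', hR'1, hP3⟩ := exists_compact_near_id v hR0 hR hε
    obtain ⟨S, hSc, hS1, hS2⟩ := ih R' (hR0.trans_le hRR') hR'1
    have hsplit : ∀ (f : HInf v) (z : ℂ), ‖((N + 1 : ℕ) : ℂ) * f z - (S + P) f z‖ ≤
        ‖N * f z - S f z‖ + ‖f z - P f z‖ := fun f z => by
      refine le_trans (le_of_eq ?_) (norm_add_le _ _)
      rw [_root_.add_apply, add_apply]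
      congr 1
      push_cast
      ring
    refine ⟨S + P, hSc.add hPc, fun f z hz => ?_, fun f z hz => ?_⟩
    · have hv := (v.pos z hz).le
      have h1 := mul_le_mul_of_nonneg_right (hsplit f z) hv
      rw [add_mul] at h1
      have h2 : ‖f z - P f z‖ * v z ≤ ‖f z‖ * v z + ‖P f z‖ * v z := by
        rw [← add_mul]; exact mul_le_mul_of_nonneg_right (norm_sub_le _ _) hv
      have h3 := f.le_norm hz
      have hf := norm_nonneg f
      simp only [Nat.cast_add, Nat.cast_one] at h1 ⊢
      rcases le_or_gt ‖z‖ R' with h | h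
      · have h4 : ‖N * f z - S f z‖ * v z ≤ N * ε * ‖f‖ :=
          (mul_le_of_le_one_right (norm_nonneg _) (v.le_one hz)).trans (hS2 f z h)
        have h5 := hP2 f z hz
        have h6 : 0 ≤ (N : ℝ) * ‖f‖ := by positivity
        linarith
      · have h4 := hS1 f z hz
        have h5 := hP3 f z hz h
        linarith
    · have h1 := hsplit f z
      have h2 := hS2 f z (hz.trans hRR')
      have h3 := hP1 f z hz
      simp only [Nat.cast_add, Nat.cast_one] at h1 ⊢
      linarith

/-- There are compact operators `L` which approximate the identity on compact subsets of the disk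
with `‖id - L‖` as close to `1` as desired. -/
theorem exists_compact_approx_id (v : BoundaryWeight) {R ε : ℝ} (hR0 : 0 < R) (hR : R < 1)
    (hε : 0 < ε) : ∃ L : HInf v →L[ℂ] HInf v, IsCompactOperator L ∧
      (∀ f : HInf v, ‖f - L f‖ ≤ (1 + ε) * ‖f‖) ∧
      (∀ f : HInf v, ∀ z : ℂ, ‖z‖ ≤ R → ‖(f - L f) z‖ ≤ ε * ‖f‖) := by
  obtain ⟨n, hn⟩ := exists_nat_one_div_lt (half_pos hε)
  obtain ⟨S, hSc, hS1, hS2⟩ := exists_compact_sum v (half_pos hε) (n + 1) R hR0 hR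
  have hN : (0 : ℝ) < ((n + 1 : ℕ) : ℝ) := by positivity
  set N : ℕ := n + 1
  have hNc : (N : ℂ) ≠ 0 := by exact_mod_cast hN.ne'
  have hN1 : (1 : ℝ) ≤ N * (ε / 2) := by
    have : 1 / (N : ℝ) < ε / 2 := by simpa [N] using hn
    rw [div_lt_iff₀ hN] at this
    linarith
  have key : ∀ (f : HInf v) (z : ℂ), N * ‖(f - ((N : ℂ)⁻¹ • S) f) z‖ = ‖N * f z - S f z‖ := by
    intro f z
    rw [sub_apply, _root_.smul_apply, smul_apply, ← Complex.norm_natCast N,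
      ← norm_mul]
    congr 1
    field_simp
  refine ⟨(N : ℂ)⁻¹ • S, hSc.smul ((N : ℂ)⁻¹), fun f => norm_le fun z hz => ?_, fun f z hz => ?_⟩
  · have h := hS1 f z hz
    rw [← key] at h
    refine le_of_mul_le_mul_left ?_ hN
    rw [← mul_assoc]
    refine h.trans ?_
    rw [← mul_assoc]
    gcongr
    linarith
  · have h := hS2 f z hz
    rw [← key] at h
    refine le_of_mul_le_mul_left (h.trans ?_) hN
    have := mul_nonneg hN.le (mul_nonneg hε.le (norm_nonneg f))
    linarith

end HInf

/-! ### The curves `t ↦ φ_t(z)` -/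

theorem one_sub_le_norm_phi_denom {t : ℝ} (ht : t ≤ 1) (z : ℂ) :
    (t - 1) * ‖z‖ + 1 ≤ ‖((t : ℂ) - 1) * z + 1‖ := by
  have h := norm_sub_norm_le (1 : ℂ) (-(((t : ℂ) - 1) * z))
  have h1 : ‖((t : ℂ) - 1) * z‖ = (1 - t) * ‖z‖ := by
    rw [norm_mul, ← Complex.ofReal_one, ← Complex.ofReal_sub, Complex.norm_real,
      Real.norm_eq_abs, abs_of_nonpos (by linarith), neg_sub]
  rw [norm_neg, h1, norm_one, sub_neg_eq_add, add_comm (1 : ℂ)] at h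
  linarith

theorem phi_denom_real_pos {t r : ℝ} (ht : t ∈ Icc (0 : ℝ) 1) (hr0 : 0 ≤ r) (hr : r < 1) :
    0 < (t - 1) * r + 1 := by nlinarith [ht.1, ht.2]

theorem norm_phi_denom_pos {t : ℝ} (ht : t ∈ Icc (0 : ℝ) 1) {z : ℂ} (hz : z ∈ unitDisk) :
    0 < ‖((t : ℂ) - 1) * z + 1‖ :=
  (phi_denom_real_pos ht (norm_nonneg z) (by simpa using hz)).trans_le
    (one_sub_le_norm_phi_denom ht.2 z)

theorem phi_denom_ne_zero {t : ℝ} (ht : t ∈ Icc (0 : ℝ) 1) {z : ℂ} (hz : z ∈ unitDisk) :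
    ((t : ℂ) - 1) * z + 1 ≠ 0 := norm_pos_iff.1 (norm_phi_denom_pos ht hz)

theorem phi_ofReal (t r : ℝ) : phi t r = ((t / ((t - 1) * r + 1) : ℝ) : ℂ) := by
  rw [phi]; push_cast; rfl

theorem phi_apply_zero (t : ℝ) : phi t 0 = t := by simp [phi]

theorem phi_zero (z : ℂ) : phi 0 z = 0 := by simp [phi]

theorem phi_one (z : ℂ) : phi 1 z = 1 := by simp [phi]

theorem norm_phi_le {t : ℝ} (ht : t ∈ Icc (0 : ℝ) 1) {z : ℂ} (hz : z ∈ unitDisk) :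
    ‖phi t z‖ ≤ t / ((t - 1) * ‖z‖ + 1) := by
  rw [phi, norm_div, Complex.norm_of_nonneg ht.1]
  exact div_le_div_of_nonneg_left ht.1
    (phi_denom_real_pos ht (norm_nonneg z) (by simpa using hz)) (one_sub_le_norm_phi_denom ht.2 z)

theorem phi_real_mem_Ioo {t r : ℝ} (ht : t ∈ Ioo (0 : ℝ) 1) (hr0 : 0 ≤ r) (hr : r < 1) :
    t / ((t - 1) * r + 1) ∈ Ioo (0 : ℝ) 1 := by
  have h := phi_denom_real_pos (Ioo_subset_Icc_self ht) hr0 hr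
  exact ⟨div_pos ht.1 h, (div_lt_one h).2 (by nlinarith [ht.1, ht.2])⟩

theorem phi_mem_unitDisk {t : ℝ} (ht : t ∈ Ioo (0 : ℝ) 1) {z : ℂ} (hz : z ∈ unitDisk) :
    phi t z ∈ unitDisk :=
  mem_ball_zero_iff.2 ((norm_phi_le (Ioo_subset_Icc_self ht) hz).trans_lt
    (phi_real_mem_Ioo ht (norm_nonneg z) (by simpa using hz)).2)

theorem norm_phi_le_one {t : ℝ} (ht : t ∈ Icc (0 : ℝ) 1) {z : ℂ} (hz : z ∈ unitDisk) :
    ‖phi t z‖ ≤ 1 := by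
  refine (norm_phi_le ht hz).trans ?_
  have hz1 : ‖z‖ < 1 := by simpa using hz
  have h := phi_denom_real_pos ht (norm_nonneg z) hz1
  exact (div_le_one h).2 (by nlinarith [ht.1, ht.2])

/-- The derivative of `φ_t(z)` with respect to `t`. -/
noncomputable def phiDeriv (t : ℝ) (z : ℂ) : ℂ := (1 - z) / (((t : ℂ) - 1) * z + 1) ^ 2

theorem hasDerivAt_phi {t : ℝ} (ht : t ∈ Icc (0 : ℝ) 1) {z : ℂ} (hz : z ∈ unitDisk) :
    HasDerivAt (fun s : ℝ => phi s z) (phiDeriv t z) t := by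
  have h0 := phi_denom_ne_zero ht hz
  have h1 : HasDerivAt (fun s : ℝ => (s : ℂ)) 1 t := Complex.ofRealCLM.hasDerivAt
  have h2 := h1.div (((h1.sub_const 1).mul_const z).add_const 1) h0
  refine h2.congr_deriv ?_
  rw [phiDeriv]
  congr 1
  ring

theorem hasDerivAt_phi_real {t r : ℝ} (ht : t ∈ Icc (0 : ℝ) 1) (hr0 : 0 ≤ r) (hr : r < 1) :
    HasDerivAt (fun s : ℝ => s / ((s - 1) * r + 1)) ((1 - r) / ((t - 1) * r + 1) ^ 2) t := by
  have h0 := (phi_denom_real_pos ht hr0 hr).ne'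
  have h1 := hasDerivAt_id t
  have h2 := h1.div (((h1.sub_const 1).mul_const r).add_const 1) h0
  refine h2.congr_deriv ?_
  simp only [id]
  congr 1
  ring

theorem kernelT_eq (K : ℂ → ℂ → ℂ) {t : ℝ} (ht : t ∈ Icc (0 : ℝ) 1) {z : ℂ} (hz : z ∈ unitDisk) :
    kernelT K t z = K z (phi t z) * phiDeriv t z := by
  rw [kernelT, (hasDerivAt_phi ht hz).deriv]

theorem continuousOn_phi {z : ℂ} (hz : z ∈ unitDisk) :
    ContinuousOn (fun t : ℝ => phi t z) (Icc 0 1) := fun _ ht =>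
  (hasDerivAt_phi ht hz).continuousAt.continuousWithinAt

theorem continuousOn_phiDeriv {z : ℂ} (hz : z ∈ unitDisk) :
    ContinuousOn (fun t : ℝ => phiDeriv t z) (Icc 0 1) := by
  refine ContinuousOn.div (by fun_prop) (by fun_prop) fun t ht => ?_
  exact pow_ne_zero 2 (phi_denom_ne_zero ht hz)

theorem norm_phiDeriv_le {t : ℝ} (ht : t ∈ Icc (0 : ℝ) 1) {z : ℂ} (hz : z ∈ unitDisk) :
    ‖phiDeriv t z‖ ≤ 2 / (1 - ‖z‖) ^ 2 := by
  have hz1 : ‖z‖ < 1 := by simpa using hz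
  have h1 := one_sub_le_norm_phi_denom ht.2 z
  rw [phiDeriv, norm_div, norm_pow]
  have h2 : ‖1 - z‖ ≤ 2 := (norm_sub_le _ _).trans (by rw [norm_one]; linarith)
  have h3 : 1 - ‖z‖ ≤ ‖((t : ℂ) - 1) * z + 1‖ := by nlinarith [ht.1, norm_nonneg z]
  have h4 : 0 < 1 - ‖z‖ := by linarith
  gcongr

/-- A quantitative form of the fact that, for fixed `t`, the minimum of `|(t - 1) z + 1|` over the
closed disk is attained only at `z = 1`. -/
theorem sq_add_le_norm_phi_denom_sq {t : ℝ} (ht : t ∈ Ioo (0 : ℝ) 1) {z : ℂ} (hz : z ∈ unitDisk) :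
    t ^ 2 + (1 - t) * ‖z - 1‖ ^ 2 ≤ ‖((t : ℂ) - 1) * z + 1‖ ^ 2 := by
  have hz1 : ‖z‖ ^ 2 ≤ 1 := pow_le_one₀ (norm_nonneg z) (by simpa using (mem_ball_zero_iff.1 hz).le)
  rw [← Complex.normSq_eq_norm_sq, Complex.normSq_apply] at hz1
  rw [← Complex.normSq_eq_norm_sq, ← Complex.normSq_eq_norm_sq, Complex.normSq_apply,
    Complex.normSq_apply]
  simp only [Complex.sub_re, Complex.sub_im, Complex.one_re, Complex.one_im, Complex.add_re,
    Complex.add_im, Complex.mul_re, Complex.mul_im, Complex.ofReal_re, Complex.ofReal_im]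
  nlinarith [mul_nonneg (mul_pos ht.1 (sub_pos.2 ht.2)).le (sub_nonneg.2 hz1)]

/-- For fixed `t` the modulus of `φ_t(z)` approaches `1` only when `z` approaches `1`. -/
theorem exists_forall_lt_norm_phi {t : ℝ} (ht : t ∈ Ioo (0 : ℝ) 1) {p : ℂ → Prop}
    (h : ∀ᶠ z in 𝓝[unitDisk] (1 : ℂ), p z) :
    ∃ R < 1, ∀ z ∈ unitDisk, R < ‖phi t z‖ → p z := by
  obtain ⟨δ, hδ, hp⟩ := Metric.mem_nhdsWithin_iff.1 h
  have h1t : 0 < 1 - t := sub_pos.2 ht.2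
  have ht0 := ht.1
  -- the square of `R` is `t² / (t² + (1 - t) δ²)`
  set q := t ^ 2 + (1 - t) * δ ^ 2 with hq
  have hq0 : 0 < q := by positivity
  refine ⟨√(t ^ 2 / q), ?_, fun z hz hR => hp ⟨?_, hz⟩⟩
  · rw [Real.sqrt_lt' one_pos, one_pow, div_lt_one hq0, hq]
    have : 0 < (1 - t) * δ ^ 2 := by positivity
    linarith
  · rw [Metric.mem_ball, dist_eq_norm]
    by_contra! hcon
    have hd := norm_phi_denom_pos (Ioo_subset_Icc_self ht) hz
    have h1 := sq_add_le_norm_phi_denom_sq ht hz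
    have h2 : q ≤ ‖((t : ℂ) - 1) * z + 1‖ ^ 2 := by
      refine le_trans ?_ h1
      rw [hq]
      gcongr
    have h3 : ‖phi t z‖ ^ 2 ≤ t ^ 2 / q := by
      rw [phi, norm_div, Complex.norm_of_nonneg ht0.le, div_pow]
      gcongr
    exact absurd (Real.le_sqrt_of_sq_le h3) (not_le.2 hR)

theorem tendsto_phi_one {t : ℝ} (ht : t ∈ Ioo (0 : ℝ) 1) :
    Tendsto (fun z => phi t z) (𝓝 (1 : ℂ)) (𝓝 1) := by
  have ht0 : (t : ℂ) ≠ 0 := by exact_mod_cast ht.1.ne'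
  have : ContinuousAt (fun z => phi t z) (1 : ℂ) := by
    unfold phi
    refine ContinuousAt.div (by fun_prop) (by fun_prop) ?_
    simpa using ht0
  have h := this.tendsto
  have h1 : phi t 1 = 1 := by
    rw [phi, mul_one, sub_add_cancel, div_self ht0]
  rwa [h1] at h

/-! ### Change of path in the integral operator -/

theorem integrable_of_tendsto_of_enorm_le {α : Type*} [MeasurableSpace α] {μ : Measure α}
    {F : ℕ → α → ℂ} {f : α → ℂ} {b : α → ℝ≥0∞} (hF : ∀ n, AEStronglyMeasurable (F n) μ)
    (hb : ∀ n, ∀ᵐ a ∂μ, ‖F n a‖ₑ ≤ b a) (hfin : ∫⁻ a, b a ∂μ ≠ ⊤)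
    (hlim : ∀ᵐ a ∂μ, Tendsto (fun n => F n a) atTop (𝓝 (f a))) : Integrable f μ := by
  refine ⟨aestronglyMeasurable_of_tendsto_ae _ hF hlim, (lintegral_mono_ae ?_).trans_lt hfin.lt_top⟩
  filter_upwards [hlim, ae_all_iff.2 hb] with a h1 h2
  exact le_of_tendsto h1.enorm (Eventually.of_forall h2)

/-- Dominated convergence, with a dominating function that need not be measurable. -/
theorem tendsto_integral_of_enorm_le {α : Type*} [MeasurableSpace α] {μ : Measure α}
    {F : ℕ → α → ℂ} {f : α → ℂ} {b : α → ℝ≥0∞} (hF : ∀ n, AEStronglyMeasurable (F n) μ)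
    (hb : ∀ n, ∀ᵐ a ∂μ, ‖F n a‖ₑ ≤ b a) (hfin : ∫⁻ a, b a ∂μ ≠ ⊤)
    (hlim : ∀ᵐ a ∂μ, Tendsto (fun n => F n a) atTop (𝓝 (f a))) :
    Tendsto (fun n => ∫ a, F n a ∂μ) atTop (𝓝 (∫ a, f a ∂μ)) := by
  have hf : AEStronglyMeasurable f μ := aestronglyMeasurable_of_tendsto_ae _ hF hlim
  refine tendsto_integral_of_L1 f hf (Eventually.of_forall fun n => ⟨hF n, ?_⟩) ?_
  · exact (lintegral_mono_ae (hb n)).trans_lt hfin.lt_top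
  · have h0 : ∫⁻ _, (0 : ℝ≥0∞) ∂μ = 0 := lintegral_zero
    rw [← h0]
    refine tendsto_lintegral_of_dominated_convergence' (fun a => b a + b a)
      (fun n => ((hF n).sub hf).enorm) (fun n => ?_) ?_ ?_
    · filter_upwards [ae_all_iff.2 hb, hlim] with a h1 h2
      exact enorm_sub_le.trans
        (add_le_add (h1 n) (le_of_tendsto h2.enorm (Eventually.of_forall h1)))
    · have : ∫⁻ a, (b a + b a) ∂μ = 2 * ∫⁻ a, b a ∂μ := by
        simp_rw [← two_mul]
        exact lintegral_const_mul' _ _ (by simp)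
      rw [this]
      exact ENNReal.mul_ne_top (by simp) hfin
    · filter_upwards [hlim] with a h1
      have := (h1.sub_const (f a)).enorm
      simpa using this

theorem lintegral_delta_phi_lt_top {v : BoundaryWeight}
    (hδ : ∫⁻ s in Ioo (0 : ℝ) 1, ‖HInf.delta v (s : ℂ)‖ₑ < ⊤) {r : ℝ} (hr0 : 0 ≤ r) (hr : r < 1) :
    ∫⁻ t in Ioo (0 : ℝ) 1, ‖HInf.delta v ((t / ((t - 1) * r + 1) : ℝ) : ℂ)‖ₑ < ⊤ := by
  set σ : ℝ → ℝ := fun t => t / ((t - 1) * r + 1) with hσ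
  set σ' : ℝ → ℝ := fun t => (1 - r) / ((t - 1) * r + 1) ^ 2 with hσ'
  have h1r : 0 < 1 - r := sub_pos.2 hr
  have hσ'le : ∀ t ∈ Ioo (0 : ℝ) 1, 1 - r ≤ σ' t := fun t ht => by
    have h := phi_denom_real_pos (Ioo_subset_Icc_self ht) hr0 hr
    rw [hσ', le_div_iff₀ (by positivity)]
    have : ((t - 1) * r + 1) ^ 2 ≤ 1 := pow_le_one₀ h.le (by nlinarith [ht.2])
    exact mul_le_of_le_one_right h1r.le this
  have hinj : InjOn σ (Ioo 0 1) := by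
    intro s hs t ht hst
    have h1 := (phi_denom_real_pos (Ioo_subset_Icc_self hs) hr0 hr).ne'
    have h2 := (phi_denom_real_pos (Ioo_subset_Icc_self ht) hr0 hr).ne'
    simp only [hσ] at hst
    rw [div_eq_div_iff h1 h2] at hst
    have : (s - t) * (1 - r) = 0 := by linarith
    rcases mul_eq_zero.1 this with h | h <;> linarith
  have hcv := lintegral_image_eq_lintegral_abs_deriv_mul (f := σ) (f' := σ') measurableSet_Ioo
    (fun t ht => (hasDerivAt_phi_real (Ioo_subset_Icc_self ht) hr0 hr).hasDerivWithinAt) hinj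
    (fun s => ‖HInf.delta v (s : ℂ)‖ₑ)
  have himg : σ '' Ioo 0 1 ⊆ Ioo 0 1 := by
    rintro _ ⟨t, ht, rfl⟩
    exact phi_real_mem_Ioo ht hr0 hr
  have h1 : ENNReal.ofReal (1 - r) * ∫⁻ t in Ioo (0 : ℝ) 1, ‖HInf.delta v (σ t : ℂ)‖ₑ < ⊤ := by
    rw [← lintegral_const_mul' _ _ ENNReal.ofReal_ne_top]
    calc _ ≤ ∫⁻ t in Ioo (0 : ℝ) 1, ENNReal.ofReal |σ' t| * ‖HInf.delta v (σ t : ℂ)‖ₑ := by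
          refine setLIntegral_mono' measurableSet_Ioo fun t ht => ?_
          gcongr
          exact (hσ'le t ht).trans (le_abs_self _)
      _ = ∫⁻ s in σ '' Ioo 0 1, ‖HInf.delta v (s : ℂ)‖ₑ := hcv.symm
      _ ≤ ∫⁻ s in Ioo (0 : ℝ) 1, ‖HInf.delta v (s : ℂ)‖ₑ := lintegral_mono_set himg
      _ < ⊤ := hδ
  by_contra hcon
  rw [not_lt_top_iff.1 hcon, ENNReal.mul_top (by simpa using h1r)] at h1
  exact lt_irrefl _ h1

/-- Along a dilated curve the integral of an analytic function depends only on the end points. -/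
theorem integral_dilated_path {F G : ℂ → ℂ} (hF : ContinuousOn F unitDisk)
    (hG : ∀ w ∈ unitDisk, HasDerivAt G (F w) w) {ρ : ℝ} (hρ0 : 0 ≤ ρ) (hρ : ρ < 1) {z : ℂ}
    (hz : z ∈ unitDisk) :
    ∫ t in Ioo (0 : ℝ) 1, F (ρ * phi t z) * (ρ * phiDeriv t z) = G ρ - G 0 := by
  have hmem : ∀ t ∈ Icc (0 : ℝ) 1, (ρ : ℂ) * phi t z ∈ unitDisk := fun t ht => by
    rw [mem_ball_zero_iff, norm_mul, Complex.norm_of_nonneg hρ0]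
    exact (mul_le_of_le_one_right hρ0 (norm_phi_le_one ht hz)).trans_lt hρ
  have hcont : ContinuousOn (fun t : ℝ => F (ρ * phi t z) * (ρ * phiDeriv t z)) (Icc 0 1) :=
    (hF.comp (continuousOn_const.mul (continuousOn_phi hz)) hmem).mul
      (continuousOn_const.mul (continuousOn_phiDeriv hz))
  have h := intervalIntegral.integral_eq_sub_of_hasDerivAt (a := 0) (b := 1)
    (f := fun t : ℝ => G (ρ * phi t z)) (f' := fun t : ℝ => F (ρ * phi t z) * (ρ * phiDeriv t z))
    (fun t ht => by
      rw [uIcc_of_le zero_le_one] at ht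
      exact (hG _ (hmem t ht)).comp t ((hasDerivAt_phi ht hz).const_mul (ρ : ℂ)))
    (ContinuousOn.intervalIntegrable (by rwa [uIcc_of_le zero_le_one]))
  rw [intervalIntegral.integral_of_le zero_le_one, integral_Ioc_eq_integral_Ioo] at h
  simpa [phi_zero, phi_one] using h

/-- Let the analytic function `F` be dominated by the norms of the evaluation functionals. Then the
integral of `F` along `t ↦ φ_t(z)`, a curve from `0` to `1`, does not depend on `z`: this holds for
the dilated curves, which stay in a compact subset of the disk, and passes to the limit. -/
theorem integral_path_eq {v : BoundaryWeight}
    (hδ : ∫⁻ s in Ioo (0 : ℝ) 1, ‖HInf.delta v (s : ℂ)‖ₑ < ⊤) {F : ℂ → ℂ}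
    (hF : DifferentiableOn ℂ F unitDisk) {C : ℝ} (hC : 0 ≤ C)
    (hFle : ∀ (s : ℝ) (u : ℂ), ‖u‖ ≤ s → s < 1 → ‖F u‖ ≤ C * ‖HInf.delta v (s : ℂ)‖) {z : ℂ}
    (hz : z ∈ unitDisk) :
    ∫ t in Ioo (0 : ℝ) 1, F (phi t z) * phiDeriv t z = ∫ t in Ioo (0 : ℝ) 1, F t := by
  obtain ⟨G, hG⟩ := hF.isExactOn_ball
  obtain ⟨ρ, -, hρ, hρlim⟩ := exists_seq_strictMono_tendsto' (zero_lt_one (α := ℝ))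
  have hlim : ∀ z ∈ unitDisk, Tendsto (fun n => G (ρ n) - G 0) atTop
      (𝓝 (∫ t in Ioo (0 : ℝ) 1, F (phi t z) * phiDeriv t z)) := by
    intro z hz
    have hz1 : ‖z‖ < 1 := by simpa using hz
    have hmem : ∀ n, ∀ t ∈ Icc (0 : ℝ) 1, (ρ n : ℂ) * phi t z ∈ unitDisk := fun n t ht => by
      rw [mem_ball_zero_iff, norm_mul, Complex.norm_of_nonneg (hρ n).1.le]
      exact (mul_le_of_le_one_right (hρ n).1.le (norm_phi_le_one ht hz)).trans_lt (hρ n).2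
    simp_rw [← fun n => integral_dilated_path hF.continuousOn hG (hρ n).1.le (hρ n).2 hz]
    refine tendsto_integral_of_enorm_le
      (b := fun t => ENNReal.ofReal (C * (2 / (1 - ‖z‖) ^ 2)) *
        ‖HInf.delta v ((t / ((t - 1) * ‖z‖ + 1) : ℝ) : ℂ)‖ₑ) (fun n => ?_) (fun n => ?_) ?_ ?_
    · refine ContinuousOn.aestronglyMeasurable (ContinuousOn.mono ?_ Ioo_subset_Icc_self)
        measurableSet_Ioo
      exact (hF.continuousOn.comp (continuousOn_const.mul (continuousOn_phi hz)) (hmem n)).mul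
        (continuousOn_const.mul (continuousOn_phiDeriv hz))
    · filter_upwards [ae_restrict_mem measurableSet_Ioo] with t ht
      have ht' := Ioo_subset_Icc_self ht
      have h1 := hFle _ ((ρ n : ℂ) * phi t z) (by
        rw [norm_mul, Complex.norm_of_nonneg (hρ n).1.le]
        exact (mul_le_of_le_one_left (norm_nonneg _) (hρ n).2.le).trans (norm_phi_le ht' hz))
        (phi_real_mem_Ioo ht (norm_nonneg z) hz1).2
      have h2 : ‖(ρ n : ℂ) * phiDeriv t z‖ ≤ 2 / (1 - ‖z‖) ^ 2 := by
        rw [norm_mul, Complex.norm_of_nonneg (hρ n).1.le]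
        exact (mul_le_of_le_one_left (norm_nonneg _) (hρ n).2.le).trans (norm_phiDeriv_le ht' hz)
      rw [← ofReal_norm, ← ofReal_norm, ← ENNReal.ofReal_mul (by positivity), norm_mul]
      refine ENNReal.ofReal_le_ofReal ((mul_le_mul h1 h2 (norm_nonneg _) (by positivity)).trans ?_)
      exact le_of_eq (by ring)
    · rw [lintegral_const_mul' _ _ ENNReal.ofReal_ne_top]
      exact ENNReal.mul_ne_top ENNReal.ofReal_ne_top
        (lintegral_delta_phi_lt_top hδ (norm_nonneg z) hz1).ne
    · filter_upwards [ae_restrict_mem measurableSet_Ioo] with t ht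
      have h1 : Tendsto (fun n => (ρ n : ℂ)) atTop (𝓝 1) := by
        exact_mod_cast (Complex.continuous_ofReal.tendsto 1).comp hρlim
      have h2 := h1.mul_const (phi t z)
      rw [one_mul] at h2
      have h3 := (hF.continuousOn.continuousAt
        (Metric.isOpen_ball.mem_nhds (phi_mem_unitDisk ht hz))).tendsto.comp h2
      simpa using h3.mul (h1.mul_const (phiDeriv t z))
  have h := tendsto_nhds_unique (hlim z hz) (hlim 0 (Metric.mem_ball_self one_pos))
  simpa [phi_apply_zero, phiDeriv] using h

theorem AdmissibleKernel.differentiableOn {K : ℂ → ℂ → ℂ} (hK : AdmissibleKernel K) {z : ℂ}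
    (hz : z ∈ unitDisk) : DifferentiableOn ℂ (K z) unitDisk := fun w hw => by
  have h := (hK.analytic (z, w) ⟨hz, hw⟩).differentiableAt
  have h2 : DifferentiableAt ℂ (fun w : ℂ => (z, w)) w := by fun_prop
  exact (DifferentiableAt.comp w h h2).differentiableWithinAt

theorem AdmissibleKernel.continuousOn_kernelT {K : ℂ → ℂ → ℂ} (hK : AdmissibleKernel K) {z : ℂ}
    (hz : z ∈ unitDisk) : ContinuousOn (fun t => kernelT K t z) (Ioo 0 1) := by
  refine ContinuousOn.congr ?_ fun t ht => kernelT_eq K (Ioo_subset_Icc_self ht) hz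
  exact ((hK.differentiableOn hz).continuousOn.comp
    ((continuousOn_phi hz).mono Ioo_subset_Icc_self) fun t ht => phi_mem_unitDisk ht hz).mul
    ((continuousOn_phiDeriv hz).mono Ioo_subset_Icc_self)

/-- The integral operator is an average of the weighted composition operators
`f ↦ T_t · (f ∘ φ_t)`. -/
theorem IsIntegralOperator.apply_eq {v : BoundaryWeight} {K : ℂ → ℂ → ℂ}
    (hδ : ∫⁻ s in Ioo (0 : ℝ) 1, ‖HInf.delta v (s : ℂ)‖ₑ < ⊤) (hK : AdmissibleKernel K)
    {I : HInf v →L[ℂ] HInf v} (hI : IsIntegralOperator v K I) (f : HInf v) {z : ℂ}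
    (hz : z ∈ unitDisk) :
    I f z = ∫ t in Ioo (0 : ℝ) 1, f (phi t z) * kernelT K t z := by
  obtain ⟨C, hC⟩ := hK.bounded z hz
  have hC0 : 0 ≤ C := (norm_nonneg _).trans (hC 0 (Metric.mem_ball_self one_pos))
  have h := integral_path_eq hδ (F := fun w => f w * K z w) (C := ‖f‖ * C)
    (f.differentiableOn.mul (hK.differentiableOn hz)) (by positivity) (fun s u hu hs => ?_) hz
  · rw [hI f z hz, intervalIntegral.integral_of_le zero_le_one, integral_Ioc_eq_integral_Ioo, ← h]
    refine setIntegral_congr_fun measurableSet_Ioo fun t ht => ?_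
    simp only [kernelT_eq K (Ioo_subset_Icc_self ht) hz, mul_assoc]
  · have h1 := f.norm_apply_le_delta hu hs
    have h2 := hC u (by simpa using hu.trans_lt hs)
    rw [norm_mul]
    calc ‖f u‖ * ‖K z u‖ ≤ (‖f‖ * ‖HInf.delta v (s : ℂ)‖) * C := by gcongr
      _ = ‖f‖ * C * ‖HInf.delta v (s : ℂ)‖ := by ring

/-! ### The upper bound -/

theorem essNorm_le {X Y : Type*} [NormedAddCommGroup X] [NormedSpace ℂ X] [NormedAddCommGroup Y]
    [NormedSpace ℂ Y] (T L : X →L[ℂ] Y) (hL : IsCompactOperator L) : essNorm T ≤ ‖T - L‖ :=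
  csInf_le ⟨0, by rintro _ ⟨L, -, rfl⟩; exact norm_nonneg _⟩ ⟨L, hL, rfl⟩

theorem le_essNorm {X Y : Type*} [NormedAddCommGroup X] [NormedSpace ℂ X] [NormedAddCommGroup Y]
    [NormedSpace ℂ Y] {T : X →L[ℂ] Y} {c : ℝ}
    (h : ∀ L : X →L[ℂ] Y, IsCompactOperator L → c ≤ ‖T - L‖) : c ≤ essNorm T :=
  le_csInf ⟨_, 0, isCompactOperator_zero, rfl⟩ (by rintro _ ⟨L, hL, rfl⟩; exact h L hL)

theorem essNorm_comp_subtypeL_le {X Y : Type*} [NormedAddCommGroup X] [NormedSpace ℂ X]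
    [NormedAddCommGroup Y] [NormedSpace ℂ Y] (T : X →L[ℂ] Y) (p : Submodule ℂ X) :
    essNorm (T.comp p.subtypeL) ≤ essNorm T := by
  refine le_essNorm fun L hL => (essNorm_le _ (L.comp p.subtypeL) (hL.comp_clm _)).trans ?_
  rw [← ContinuousLinearMap.sub_comp]
  exact (ContinuousLinearMap.opNorm_comp_le _ _).trans
    (mul_le_of_le_one_right (norm_nonneg _) p.norm_subtypeL_le)

/-- The supremum of `|T_t(z)| v(z) / v(φ_t(z))` over the `z` in the disk with `|φ_t(z)| > R`. -/
noncomputable def outerSup (v : BoundaryWeight) (K : ℂ → ℂ → ℂ) (R t : ℝ) : ℝ≥0∞ :=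
  ⨆ z ∈ {z : ℂ | z ∈ unitDisk ∧ R < ‖phi t z‖},
    ENNReal.ofReal (‖kernelT K t z‖ * v z / v (phi t z))

/-- The supremum of `|T_t(z)| v(z)` over the `z` in the disk with `|φ_t(z)| ≤ R`. -/
noncomputable def innerSup (v : BoundaryWeight) (K : ℂ → ℂ → ℂ) (R t : ℝ) : ℝ≥0∞ :=
  ⨆ z ∈ {z : ℂ | z ∈ unitDisk ∧ ‖phi t z‖ ≤ R}, ENNReal.ofReal (‖kernelT K t z‖ * v z)

section Sup

variable {v : BoundaryWeight} {K : ℂ → ℂ → ℂ}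

theorem le_outerSup {R t : ℝ} {z : ℂ} (hz : z ∈ unitDisk) (h : R < ‖phi t z‖) :
    ENNReal.ofReal (‖kernelT K t z‖ * v z / v (phi t z)) ≤ outerSup v K R t :=
  le_iSup₂_of_le z ⟨hz, h⟩ le_rfl

theorem le_innerSup {R t : ℝ} {z : ℂ} (hz : z ∈ unitDisk) (h : ‖phi t z‖ ≤ R) :
    ENNReal.ofReal (‖kernelT K t z‖ * v z) ≤ innerSup v K R t :=
  le_iSup₂_of_le z ⟨hz, h⟩ le_rfl

theorem outerSup_anti {R R' t : ℝ} (h : R ≤ R') : outerSup v K R' t ≤ outerSup v K R t :=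
  iSup₂_le fun _ hz => le_outerSup hz.1 (h.trans_lt hz.2)

/-- As a supremum of continuous functions on open sets, `outerSup` is lower semicontinuous. -/
theorem aemeasurable_outerSup (hK : AdmissibleKernel K) (R : ℝ) :
    AEMeasurable (outerSup v K R) (volume.restrict (Ioo (0 : ℝ) 1)) := by
  rw [← aemeasurable_indicator_iff measurableSet_Ioo]
  refine (LowerSemicontinuous.measurable fun t y hy => ?_).aemeasurable
  change y < _ at hy
  change ∀ᶠ s in 𝓝 t, y < _
  by_cases ht : t ∈ Ioo (0 : ℝ) 1
  swap
  · rw [indicator_of_notMem ht] at hy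
    exact absurd hy not_lt_zero
  rw [indicator_of_mem ht, outerSup] at hy
  simp only [lt_iSup_iff] at hy
  obtain ⟨z, ⟨hz, hR⟩, hy⟩ := hy
  have hnhds : Ioo (0 : ℝ) 1 ∈ 𝓝 t := Ioo_mem_nhds ht.1 ht.2
  have hφ : ContinuousAt (fun s : ℝ => phi s z) t :=
    (hasDerivAt_phi (Ioo_subset_Icc_self ht) hz).continuousAt
  have hT := (hK.continuousOn_kernelT hz).continuousAt hnhds
  have hφd := phi_mem_unitDisk ht hz
  have hv : ContinuousAt (fun s : ℝ => v (phi s z)) t :=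
    ContinuousAt.comp (g := v)
      (v.continuousOn.continuousAt (Metric.isOpen_ball.mem_nhds hφd)) hφ
  have hq : ContinuousAt
      (fun s => ENNReal.ofReal (‖kernelT K s z‖ * v z / v (phi s z))) t :=
    ENNReal.continuous_ofReal.continuousAt.comp
      ((hT.norm.mul continuousAt_const).div hv (v.pos _ hφd).ne')
  filter_upwards [hnhds, hφ.norm.eventually (lt_mem_nhds hR), hq.eventually (lt_mem_nhds hy)]
    with s hs h1 h2
  rw [indicator_of_mem hs]
  exact h2.trans_le (le_outerSup hz h1)

/-- The integrand of `I_K f (z) v(z)` is controlled by `outerSup` and `innerSup`. -/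
theorem enorm_apply_phi_mul_kernelT_le {R t a b : ℝ} (ht : t ∈ Ioo (0 : ℝ) 1) {z : ℂ}
    (hz : z ∈ unitDisk) {h : ℂ → ℂ} (ha : 0 ≤ a) (hb : 0 ≤ b)
    (hha : ∀ w ∈ unitDisk, ‖h w‖ * v w ≤ a) (hhb : ∀ w : ℂ, ‖w‖ ≤ R → ‖h w‖ ≤ b) :
    ‖h (phi t z) * kernelT K t z‖ₑ * ENNReal.ofReal (v z) ≤
      ENNReal.ofReal a * outerSup v K R t + ENNReal.ofReal b * innerSup v K R t := by
  have hvz := v.pos z hz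
  have hφd := phi_mem_unitDisk ht hz
  have hvφ := v.pos _ hφd
  rw [← ofReal_norm, norm_mul, ← ENNReal.ofReal_mul (by positivity)]
  rcases le_or_gt ‖phi t z‖ R with hR | hR
  · refine le_add_left (le_trans ?_ (mul_le_mul_right (le_innerSup hz hR) _))
    rw [← ENNReal.ofReal_mul hb]
    refine ENNReal.ofReal_le_ofReal ?_
    rw [mul_assoc]
    have := hhb _ hR
    gcongr
  · refine le_add_right (le_trans ?_ (mul_le_mul_right (le_outerSup hz hR) _))
    rw [← ENNReal.ofReal_mul ha]
    refine ENNReal.ofReal_le_ofReal ?_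
    calc ‖h (phi t z)‖ * ‖kernelT K t z‖ * v z
        = (‖h (phi t z)‖ * v (phi t z)) * (‖kernelT K t z‖ * v z / v (phi t z)) := by
          field_simp
      _ ≤ a * (‖kernelT K t z‖ * v z / v (phi t z)) := by
          have := hha _ hφd
          gcongr

/-- The bound for a fixed radius `R`. The compact operator subtracted from `I` is `I ∘ L`, where `L`
is close to the identity on `|w| ≤ R` and `‖id - L‖ ≤ 1 + ε`; only the contribution of
`|φ_t(z)| > R` survives as `ε → 0`. -/
theorem essNorm_le_lintegral_outerSup
    (hδ : ∫⁻ s in Ioo (0 : ℝ) 1, ‖HInf.delta v (s : ℂ)‖ₑ < ⊤) (hK : AdmissibleKernel K)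
    {I : HInf v →L[ℂ] HInf v} (hI : IsIntegralOperator v K I) {R : ℝ} (hR0 : 0 < R) (hR : R < 1)
    (hB : ∫⁻ t in Ioo (0 : ℝ) 1, innerSup v K R t < ⊤) :
    ENNReal.ofReal (essNorm I) ≤ ∫⁻ t in Ioo (0 : ℝ) 1, outerSup v K R t := by
  set A := ∫⁻ t in Ioo (0 : ℝ) 1, outerSup v K R t
  set B := ∫⁻ t in Ioo (0 : ℝ) 1, innerSup v K R t
  rcases eq_or_ne A ⊤ with hA | hA
  · rw [hA]; exact le_top
  have key : ∀ ε : ℝ, 0 < ε → ENNReal.ofReal (essNorm I) ≤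
      ENNReal.ofReal (1 + ε) * A + ENNReal.ofReal ε * B := by
    intro ε hε
    obtain ⟨L, hLc, hL1, hL2⟩ := HInf.exists_compact_approx_id v hR0 hR hε
    set X := ENNReal.ofReal (1 + ε) * A + ENNReal.ofReal ε * B
    have hX : X ≠ ⊤ := ENNReal.add_ne_top.2 ⟨ENNReal.mul_ne_top ENNReal.ofReal_ne_top hA,
      ENNReal.mul_ne_top ENNReal.ofReal_ne_top hB.ne⟩
    rw [← ENNReal.ofReal_toReal hX]
    refine ENNReal.ofReal_le_ofReal ((essNorm_le I (I.comp L) (hLc.clm_comp I)).trans ?_)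
    refine ContinuousLinearMap.opNorm_le_bound _ ENNReal.toReal_nonneg fun f =>
      HInf.norm_le fun z hz => ?_
    have hsub : (I - I.comp L) f = I (f - L f) := by
      rw [map_sub]; rfl
    have hf0 := norm_nonneg f
    rw [hsub, ← ENNReal.ofReal_le_ofReal_iff (by positivity), ENNReal.ofReal_mul (norm_nonneg _),
      ofReal_norm, hI.apply_eq hδ hK _ hz, ENNReal.ofReal_mul ENNReal.toReal_nonneg,
      ENNReal.ofReal_toReal hX]
    calc _ ≤ (∫⁻ t in Ioo (0 : ℝ) 1, ‖(f - L f) (phi t z) * kernelT K t z‖ₑ) *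
            ENNReal.ofReal (v z) := by
          gcongr
          exact enorm_integral_le_lintegral_enorm _
      _ = ∫⁻ t in Ioo (0 : ℝ) 1, ‖(f - L f) (phi t z) * kernelT K t z‖ₑ *
            ENNReal.ofReal (v z) := (lintegral_mul_const' _ _ ENNReal.ofReal_ne_top).symm
      _ ≤ ∫⁻ t in Ioo (0 : ℝ) 1, (ENNReal.ofReal ((1 + ε) * ‖f‖) * outerSup v K R t +
            ENNReal.ofReal (ε * ‖f‖) * innerSup v K R t) := by
          refine setLIntegral_mono' measurableSet_Ioo fun t ht => ?_
          exact enorm_apply_phi_mul_kernelT_le ht hz (by positivity) (by positivity)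
            (fun w hw => ((f - L f).le_norm hw).trans (hL1 f)) (hL2 f)
      _ = ENNReal.ofReal ((1 + ε) * ‖f‖) * A + ENNReal.ofReal (ε * ‖f‖) * B := by
          rw [lintegral_add_left' ((aemeasurable_outerSup hK R).const_mul _),
            lintegral_const_mul' _ _ ENNReal.ofReal_ne_top,
            lintegral_const_mul' _ _ ENNReal.ofReal_ne_top]
      _ = X * ENNReal.ofReal ‖f‖ := by
          rw [ENNReal.ofReal_mul (by positivity), ENNReal.ofReal_mul hε.le]
          ring
  have hlim : Tendsto (fun ε : ℝ => ENNReal.ofReal (1 + ε) * A + ENNReal.ofReal ε * B) (𝓝[>] 0)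
      (𝓝 (ENNReal.ofReal (1 + 0) * A + ENNReal.ofReal 0 * B)) := by
    refine Tendsto.mono_left ?_ nhdsWithin_le_nhds
    refine Tendsto.add (ENNReal.Tendsto.mul_const (ENNReal.tendsto_ofReal ?_) (Or.inr hA))
      (ENNReal.Tendsto.mul_const (ENNReal.tendsto_ofReal tendsto_id) (Or.inr hB.ne))
    exact tendsto_const_nhds.add tendsto_id
  have := ge_of_tendsto hlim (eventually_mem_nhdsWithin.mono fun ε hε => key ε hε)
  simpa using this

theorem limsup_le_outerSup {t : ℝ} (ht : t ∈ Ioo (0 : ℝ) 1) {R : ℝ} (hR : R < 1) :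
    limsup (fun z => ENNReal.ofReal (v z / v (phi t z) * ‖kernelT K t z‖)) (𝓝[unitDisk] (1 : ℂ)) ≤
      outerSup v K R t := by
  refine limsup_le_of_le (by isBoundedDefault) ?_
  have h1 := ((tendsto_phi_one ht).mono_left nhdsWithin_le_nhds :
    Tendsto _ (𝓝[unitDisk] (1 : ℂ)) _).norm.eventually
    (lt_mem_nhds (by simpa using hR : R < ‖(1 : ℂ)‖))
  filter_upwards [h1, self_mem_nhdsWithin] with z hz hzd
  refine le_trans (le_of_eq ?_) (le_outerSup hzd hz)
  congr 1
  ring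

/-- Since `|φ_t(z)| → 1` exactly when `z → 1`, the suprema over `|φ_t(z)| > R` decrease to the
limit superior at `1`. -/
theorem tendsto_outerSup {t : ℝ} (ht : t ∈ Ioo (0 : ℝ) 1) {R : ℕ → ℝ} (hR1 : ∀ n, R n < 1)
    (hR : Tendsto R atTop (𝓝 1)) :
    Tendsto (fun n => outerSup v K (R n) t) atTop
      (𝓝 (limsup (fun z => ENNReal.ofReal (v z / v (phi t z) * ‖kernelT K t z‖))
        (𝓝[unitDisk] (1 : ℂ)))) := by
  refine tendsto_order.2 ⟨fun a ha => Eventually.of_forall fun n =>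
    ha.trans_le (limsup_le_outerSup ht (hR1 n)), fun a ha => ?_⟩
  obtain ⟨b, hb, hba⟩ := exists_between ha
  obtain ⟨r, hr, hrb⟩ := exists_forall_lt_norm_phi ht (eventually_lt_of_limsup_lt hb)
  filter_upwards [hR.eventually (lt_mem_nhds hr)] with n hn
  refine lt_of_le_of_lt (iSup₂_le fun z hz => ?_) hba
  refine le_trans (le_of_eq ?_) (hrb z hz.1 (hn.trans hz.2)).le
  congr 1
  ring

theorem essNorm_le_limsupIntegral
    (hδ : ∫⁻ s in Ioo (0 : ℝ) 1, ‖HInf.delta v (s : ℂ)‖ₑ < ⊤) (hK : AdmissibleKernel K)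
    {I : HInf v →L[ℂ] HInf v} (hI : IsIntegralOperator v K I) (hCUBH : CondCUBH v K)
    (hCUB2H : CondCUB2H v K) : ENNReal.ofReal (essNorm I) ≤ limsupIntegral v K := by
  obtain ⟨R₀, hR₀, hfin⟩ := hCUBH
  obtain ⟨R, -, hR, hlim⟩ := exists_seq_strictMono_tendsto' hR₀.2
  have h := tendsto_lintegral_of_dominated_convergence' (μ := volume.restrict (Ioo (0 : ℝ) 1))
    (outerSup v K R₀) (fun n => aemeasurable_outerSup hK (R n))
    (fun n => Eventually.of_forall fun t => outerSup_anti (hR n).1.le) hfin.ne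
    (by
      filter_upwards [ae_restrict_mem measurableSet_Ioo] with t ht
      exact tendsto_outerSup ht (fun n => (hR n).2) hlim)
  refine ge_of_tendsto h (Eventually.of_forall fun n => ?_)
  have hn0 : 0 < R n := hR₀.1.trans (hR n).1
  exact essNorm_le_lintegral_outerSup hδ hK hI hn0 (hR n).2 (hCUB2H _ ⟨hn0, (hR n).2⟩)

end Sup

/-! ### Compact operators on `H^0_v` and null sequences -/

theorem HInf.norm_le_iff {v : BoundaryWeight} {f : HInf v} {C : ℝ} :
    ‖f‖ ≤ C ↔ ∀ z ∈ unitDisk, ‖f z‖ * v z ≤ C :=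
  ⟨fun h _ hz => (f.le_norm hz).trans h, HInf.norm_le⟩

/-- A bounded sequence in `H^0_v` which tends to zero uniformly on compact sets contains humps
living on essentially disjoint annuli; their sums stay bounded. -/
theorem exists_bounded_sum_of_humps {v : BoundaryWeight} {Y : Type*} [NormedAddCommGroup Y]
    [NormedSpace ℂ Y] (L : HZero v →L[ℂ] Y) {f : ℕ → HZero v} (hf1 : ∀ n, ‖f n‖ ≤ 1)
    (hf0 : ∀ R < 1, ∀ ε > 0, ∀ᶠ n in atTop, ∀ z : ℂ, ‖z‖ ≤ R → ‖(f n : HInf v) z‖ ≤ ε) {y : Y}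
    (hy : Tendsto (fun n => L (f n)) atTop (𝓝 y)) {ε : ℝ} (hε : 0 < ε) (N : ℕ) :
    ∃ S : HZero v, ‖S‖ ≤ 1 + N * ε ∧ ‖L S - N • y‖ ≤ N * ε := by
  induction N with
  | zero => exact ⟨0, by simp, by simp⟩
  | succ N ih =>
    obtain ⟨S, hS1, hS2⟩ := ih
    obtain ⟨R, hR, hSR⟩ := eventually_toBoundary_iff.1
      ((S.2 : Tendsto (fun z => ‖(S : HInf v) z‖ * v z) toBoundary (𝓝 0)).eventually
        (ge_mem_nhds hε))
    obtain ⟨n, hn1, hn2⟩ := ((hf0 R hR ε hε).and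
      (hy.eventually (Metric.closedBall_mem_nhds y hε))).exists
    refine ⟨S + f n, ?_, ?_⟩
    · change ‖((S : HInf v) + (f n : HInf v))‖ ≤ _
      refine HInf.norm_le fun z hz => ?_
      have hv := v.pos z hz
      have h1 := mul_le_mul_of_nonneg_right
        (norm_add_le ((S : HInf v) z) ((f n : HInf v) z)) hv.le
      rw [add_mul] at h1
      rw [HInf.add_apply]
      refine h1.trans ?_
      push_cast
      rcases le_or_gt ‖z‖ R with h | h
      · have h2 : ‖(S : HInf v) z‖ * v z ≤ 1 + N * ε := HInf.norm_le_iff.1 hS1 z hz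
        have h3 : ‖(f n : HInf v) z‖ * v z ≤ ε :=
          (mul_le_of_le_one_right (norm_nonneg _) (v.le_one hz)).trans (hn1 z h)
        linarith
      · have h2 := hSR z hz h
        have h3 : ‖(f n : HInf v) z‖ * v z ≤ 1 := HInf.norm_le_iff.1 (hf1 n) z hz
        have : 0 ≤ N * ε := by positivity
        linarith
    · have h1 : L (S + f n) - (N + 1) • y = (L S - N • y) + (L (f n) - y) := by
        rw [map_add, add_smul, one_smul]; abel
      rw [h1]
      refine (norm_add_le _ _).trans ?_
      have h2 : ‖L (f n) - y‖ ≤ ε := by rwa [← dist_eq_norm]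
      push_cast
      linarith

/-- Compact operators on `H^0_v` annihilate bounded, locally uniformly null sequences in the limit.
If `L (f n)` accumulated at `y ≠ 0`, sums `S` of `N` humps would have bounded norm while `L S` is
close to `N y`. -/
theorem IsCompactOperator.tendsto_zero_of_locally_null {v : BoundaryWeight} {Y : Type*}
    [NormedAddCommGroup Y] [NormedSpace ℂ Y] {L : HZero v →L[ℂ] Y} (hL : IsCompactOperator L)
    {f : ℕ → HZero v} (hf1 : ∀ n, ‖f n‖ ≤ 1)
    (hf0 : ∀ R < 1, ∀ ε > 0, ∀ᶠ n in atTop, ∀ z : ℂ, ‖z‖ ≤ R → ‖(f n : HInf v) z‖ ≤ ε) :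
    Tendsto (fun n => L (f n)) atTop (𝓝 0) := by
  refine tendsto_of_subseq_tendsto fun ns hns => ?_
  have hc := hL.isCompact_closure_image_closedBall (𝕜₁ := ℂ) (f := L.toLinearMap) 1
  obtain ⟨y, -, φ, hφ, hy⟩ := hc.tendsto_subseq (x := fun n => L (f (ns n))) fun n =>
    subset_closure ⟨f (ns n), by simpa using hf1 (ns n), rfl⟩
  refine ⟨φ, ?_⟩
  suffices y = 0 by rw [← this]; exact hy
  by_contra hy0
  have hypos : 0 < ‖y‖ := norm_pos_iff.2 hy0
  set ε := ‖y‖ / (2 * (1 + ‖L‖)) with hε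
  have hL0 := norm_nonneg L
  have hεpos : 0 < ε := by positivity
  obtain ⟨N, hN⟩ := exists_nat_gt (2 * ‖L‖ / ‖y‖)
  have hsub : Tendsto (fun n => ns (φ n)) atTop atTop := hns.comp hφ.tendsto_atTop
  obtain ⟨S, hS1, hS2⟩ := exists_bounded_sum_of_humps L (f := fun n => f (ns (φ n)))
    (fun n => hf1 _) (fun R hR δ hδ => hsub.eventually (hf0 R hR δ hδ)) hy hεpos N
  have h1 : N * ‖y‖ ≤ ‖L S‖ + N * ε := by
    have h2 := norm_le_norm_add_norm_sub (L S) (N • y)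
    have h3 : ‖(N • y : Y)‖ = N * ‖y‖ := by
      rw [← Nat.cast_smul_eq_nsmul ℝ, norm_smul, Real.norm_natCast]
    linarith
  have h2 : ‖L S‖ ≤ ‖L‖ * (1 + N * ε) := (L.le_opNorm S).trans (by gcongr)
  have h3 : (1 + ‖L‖) * ε = ‖y‖ / 2 := by rw [hε]; field_simp
  have h4 : N * ((1 + ‖L‖) * ε) = N * (‖y‖ / 2) := by rw [h3]
  rw [div_lt_iff₀ hypos] at hN
  nlinarith

/-! ### Functions peaking near the boundary point `1` -/

/-- The function `z ^ n ((1 - z) / 2) ^ (1 / (n + 1))`: bounded by `1` on the disk, zero at `1`, and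
converging to zero on compact sets, yet close to `1` at the points `φ_t(1 - (n + 1)⁻²)`. -/
noncomputable def peak (n : ℕ) (z : ℂ) : ℂ := z ^ n * ((1 - z) / 2) ^ ((1 / ((n : ℝ) + 1) : ℝ) : ℂ)

theorem differentiableOn_peak (n : ℕ) : DifferentiableOn ℂ (peak n) unitDisk := by
  refine DifferentiableOn.mul (by fun_prop) (DifferentiableOn.cpow (by fun_prop) (by fun_prop) ?_)
  intro z hz
  have h1 : z.re < 1 := (Complex.re_le_norm z).trans_lt (by simpa using hz)
  left
  have : ((1 - z) / 2).re = (1 - z.re) / 2 := by simp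
  rw [this]
  linarith

theorem norm_peak (n : ℕ) (z : ℂ) :
    ‖peak n z‖ = ‖z‖ ^ n * (‖1 - z‖ / 2) ^ (1 / ((n : ℝ) + 1)) := by
  rw [peak, norm_mul, norm_pow, Complex.norm_cpow_real, norm_div, Complex.norm_ofNat]

theorem norm_peak_le (n : ℕ) {z : ℂ} (hz : z ∈ unitDisk) : ‖peak n z‖ ≤ ‖z‖ ^ n := by
  have hz1 : ‖z‖ < 1 := by simpa using hz
  rw [norm_peak]
  refine mul_le_of_le_one_right (by positivity)
    (Real.rpow_le_one (by positivity) ?_ (by positivity))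
  have := norm_sub_le (1 : ℂ) z
  rw [norm_one] at this
  linarith

theorem norm_peak_le_one (n : ℕ) {z : ℂ} (hz : z ∈ unitDisk) : ‖peak n z‖ ≤ 1 :=
  (norm_peak_le n hz).trans
    (pow_le_one₀ (norm_nonneg _) (by simpa using (mem_ball_zero_iff.1 hz).le))

theorem tendsto_peak_one (n : ℕ) : Tendsto (fun z => ‖peak n z‖) (𝓝 1) (𝓝 0) := by
  simp_rw [norm_peak]
  have hn : (0 : ℝ) < 1 / ((n : ℝ) + 1) := by positivity
  have h : ContinuousAt (fun z : ℂ => ‖z‖ ^ n * (‖1 - z‖ / 2) ^ (1 / ((n : ℝ) + 1))) 1 := by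
    refine ContinuousAt.mul (by fun_prop) (ContinuousAt.rpow_const (by fun_prop) (Or.inr hn.le))
  have h2 := h.tendsto
  rwa [sub_self, norm_zero, zero_div, Real.zero_rpow hn.ne', mul_zero] at h2

/-- A function that tends to zero at every point of the unit circle does so uniformly. -/
theorem tendsto_toBoundary_zero {u : ℂ → ℝ}
    (h : ∀ ζ : ℂ, ‖ζ‖ = 1 → Tendsto u (𝓝[unitDisk] ζ) (𝓝 0)) : Tendsto u toBoundary (𝓝 0) := by
  refine tendsto_def.2 fun s hs => ?_
  have h1 : ∀ᶠ z in 𝓝ˢ (Metric.sphere (0 : ℂ) 1), z ∈ unitDisk → z ∈ u ⁻¹' s := by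
    rw [eventually_nhdsSet_iff_forall]
    intro ζ hζ
    exact eventually_nhdsWithin_iff.1 (h ζ (by simpa using hζ) hs)
  obtain ⟨δ, hδ, hsub⟩ :=
    (Metric.hasBasis_nhdsSet_thickening (isCompact_sphere (0 : ℂ) 1)).mem_iff.1 h1
  refine eventually_toBoundary_iff.2 ⟨max 0 (1 - δ), max_lt one_pos (by linarith),
    fun z hz hR => hsub ?_ hz⟩
  have hz0 : 0 < ‖z‖ := (le_max_left _ _).trans_lt hR
  have hz1 : ‖z‖ < 1 := by simpa using hz
  have hzδ : 1 - δ < ‖z‖ := (le_max_right _ _).trans_lt hR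
  refine Metric.mem_thickening_iff.2 ⟨((‖z‖⁻¹ : ℝ) : ℂ) * z, ?_, ?_⟩
  · rw [mem_sphere_zero_iff_norm, norm_mul, Complex.norm_of_nonneg (by positivity),
      inv_mul_cancel₀ hz0.ne']
  · have h2 : z - ((‖z‖⁻¹ : ℝ) : ℂ) * z = ((1 - ‖z‖⁻¹ : ℝ) : ℂ) * z := by push_cast; ring
    have h3 : 1 ≤ ‖z‖⁻¹ := (one_le_inv₀ hz0).2 hz1.le
    rw [dist_eq_norm, h2, norm_mul, Complex.norm_real, Real.norm_eq_abs,
      abs_of_nonpos (by linarith), neg_sub, sub_mul, inv_mul_cancel₀ hz0.ne']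
    linarith

section TestFunctions

variable {v : BoundaryWeight} {g : ℂ → ℂ}

theorem AdmissibleG.norm_mul_peak_le (hg : AdmissibleG v g) (n : ℕ) {z : ℂ} (hz : z ∈ unitDisk) :
    ‖g z * peak n z‖ * v z ≤ 1 := by
  rw [norm_mul, mul_right_comm]
  exact mul_le_one₀ (hg.le_one z hz) (norm_nonneg _) (norm_peak_le_one n hz)

/-- The test functions `g · peak n`. -/
noncomputable def AdmissibleG.test (hg : AdmissibleG v g) (n : ℕ) : HInf v :=
  HInf.mk (fun z => g z * peak n z) (hg.analytic.mul (differentiableOn_peak n)) 1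
    fun _ hz => hg.norm_mul_peak_le n hz

theorem AdmissibleG.test_apply (hg : AdmissibleG v g) (n : ℕ) {z : ℂ} (hz : z ∈ unitDisk) :
    hg.test n z = g z * peak n z := HInf.mk_apply hz

theorem AdmissibleG.norm_test_le (hg : AdmissibleG v g) (n : ℕ) : ‖hg.test n‖ ≤ 1 :=
  HInf.norm_le fun z hz => by rw [hg.test_apply n hz]; exact hg.norm_mul_peak_le n hz

theorem AdmissibleG.test_mem_hZero (hg : AdmissibleG v g) (n : ℕ) : hg.test n ∈ HZero v := by
  refine tendsto_toBoundary_zero fun ζ hζ => ?_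
  have hev : ∀ᶠ z in 𝓝[unitDisk] ζ, z ∈ unitDisk := self_mem_nhdsWithin
  have h0 : ∀ᶠ z in 𝓝[unitDisk] ζ, 0 ≤ ‖hg.test n z‖ * v z :=
    hev.mono fun z hz => mul_nonneg (norm_nonneg _) (v.pos z hz).le
  by_cases h1 : ζ = 1
  · subst h1
    refine squeeze_zero' h0 (hev.mono fun z hz => ?_)
      ((tendsto_peak_one n).mono_left nhdsWithin_le_nhds)
    rw [hg.test_apply n hz, norm_mul, mul_right_comm]
    exact mul_le_of_le_one_left (norm_nonneg _) (hg.le_one z hz)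
  · refine squeeze_zero' h0 (hev.mono fun z hz => ?_) (hg.tendsto_zero ζ hζ h1)
    rw [hg.test_apply n hz, norm_mul, mul_right_comm]
    exact mul_le_of_le_one_right (mul_nonneg (norm_nonneg _) (v.pos z hz).le)
      (norm_peak_le_one n hz)

theorem AdmissibleG.test_locally_null (hg : AdmissibleG v g) {R : ℝ} (hR : R < 1) {ε : ℝ}
    (hε : 0 < ε) : ∀ᶠ n in atTop, ∀ z : ℂ, ‖z‖ ≤ R → ‖hg.test n z‖ ≤ ε := by
  rcases lt_or_ge R 0 with hR0 | hR0
  · exact Eventually.of_forall fun n z hz => absurd (hz.trans_lt hR0) (not_lt.2 (norm_nonneg z))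
  obtain ⟨m, hm, hmv⟩ := v.exists_pos_le hR
  have h := (tendsto_pow_atTop_nhds_zero_of_lt_one hR0 hR).const_mul m⁻¹
  rw [mul_zero] at h
  filter_upwards [h.eventually (ge_mem_nhds hε)] with n hn z hz
  have hzd : z ∈ unitDisk := by simpa using hz.trans_lt hR
  have h1 : ‖g z‖ ≤ m⁻¹ := by
    rw [← one_div, le_div_iff₀ hm]
    exact (mul_le_mul_of_nonneg_left (hmv z hz) (norm_nonneg _)).trans (hg.le_one z hzd)
  have h2 : ‖peak n z‖ ≤ R ^ n :=
    (norm_peak_le n hzd).trans (pow_le_pow_left₀ (norm_nonneg z) hz n)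
  rw [hg.test_apply n hzd, norm_mul]
  exact (mul_le_mul h1 h2 (norm_nonneg _) (by positivity)).trans hn

end TestFunctions

/-- The radii `1 - (n + 1)⁻²` at which the test functions are evaluated. -/
noncomputable def testRadius (n : ℕ) : ℝ := 1 - 1 / ((n : ℝ) + 1) ^ 2

theorem testRadius_mem (n : ℕ) : testRadius n ∈ Ico (0 : ℝ) 1 := by
  have h : (1 : ℝ) ≤ ((n : ℝ) + 1) ^ 2 := one_le_pow₀ (by linarith [n.cast_nonneg (α := ℝ)])
  refine ⟨sub_nonneg.2 ((div_le_one (by positivity)).2 h), sub_lt_self _ (by positivity)⟩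

theorem testRadius_mem_unitDisk (n : ℕ) : (testRadius n : ℂ) ∈ unitDisk := by
  rw [mem_ball_zero_iff, Complex.norm_of_nonneg (testRadius_mem n).1]
  exact (testRadius_mem n).2

theorem tendsto_testRadius : Tendsto testRadius atTop (𝓝[<] 1) := by
  refine tendsto_nhdsWithin_iff.2 ⟨?_, Eventually.of_forall fun n => (testRadius_mem n).2⟩
  have h := (tendsto_one_div_add_atTop_nhds_zero_nat (𝕜 := ℝ)).pow 2
  have h2 := (tendsto_const_nhds (x := (1 : ℝ))).sub h
  rw [zero_pow two_ne_zero, sub_zero] at h2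
  refine h2.congr fun n => ?_
  rw [testRadius, div_pow, one_pow]

theorem tendsto_testRadius_complex :
    Tendsto (fun n => (testRadius n : ℂ)) atTop (𝓝[unitDisk] (1 : ℂ)) := by
  refine tendsto_nhdsWithin_iff.2 ⟨?_, Eventually.of_forall testRadius_mem_unitDisk⟩
  exact_mod_cast (Complex.continuous_ofReal.tendsto 1).comp
    (tendsto_testRadius.mono_right nhdsWithin_le_nhds)

/-- At `φ_t (testRadius n)` the distance to `1` is so small that `z ^ n` is close to `1`, but not so
small that `((1 - z) / 2) ^ (1 / (n + 1))` is not. -/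
theorem tendsto_peak_phi_testRadius {t : ℝ} (ht : t ∈ Ioo (0 : ℝ) 1) :
    Tendsto (fun n => peak n (phi t (testRadius n))) atTop (𝓝 1) := by
  have ht0 := ht.1
  have h1t : 0 < 1 - t := sub_pos.2 ht.2
  set p : ℕ → ℝ := fun n => t / ((t - 1) * testRadius n + 1) with hp
  have hpmem : ∀ n, p n ∈ Ioo (0 : ℝ) 1 := fun n =>
    phi_real_mem_Ioo ht (testRadius_mem n).1 (testRadius_mem n).2
  -- the distance from `p n` to `1` is comparable to `(n + 1)⁻²`
  have hsub : ∀ n, 1 - p n = (1 - t) * (1 / ((n : ℝ) + 1) ^ 2) / ((t - 1) * testRadius n + 1) := by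
    intro n
    have h := (phi_denom_real_pos (Ioo_subset_Icc_self ht) (testRadius_mem n).1
      (testRadius_mem n).2).ne'
    rw [hp, eq_div_iff h, sub_mul, div_mul_cancel₀ _ h, testRadius]
    ring
  have hle : ∀ n, 1 - p n ≤ 1 / t * (1 / ((n : ℝ) + 1) ^ 2) := by
    intro n
    have h : t ≤ (t - 1) * testRadius n + 1 := by nlinarith [(testRadius_mem n).2]
    rw [hsub, div_mul_eq_mul_div, one_mul]
    have : (1 - t) * (1 / ((n : ℝ) + 1) ^ 2) ≤ 1 / ((n : ℝ) + 1) ^ 2 :=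
      mul_le_of_le_one_left (by positivity) (by linarith)
    gcongr
  have hge : ∀ n : ℕ, (1 - t) * (1 / ((n : ℝ) + 1) ^ 2) ≤ 1 - p n := by
    intro n
    have h := phi_denom_real_pos (Ioo_subset_Icc_self ht) (testRadius_mem n).1
      (testRadius_mem n).2
    rw [hsub, le_div_iff₀ h]
    exact mul_le_of_le_one_right (by positivity) (by nlinarith [(testRadius_mem n).1])
  have hpow : Tendsto (fun n => p n ^ n) atTop (𝓝 1) := by
    have hlow : Tendsto (fun n : ℕ => 1 - 1 / t * (1 / ((n : ℝ) + 1))) atTop (𝓝 1) := by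
      simpa using (tendsto_one_div_add_atTop_nhds_zero_nat (𝕜 := ℝ)).const_mul (1 / t)
        |>.const_sub 1
    refine tendsto_of_tendsto_of_tendsto_of_le_of_le hlow tendsto_const_nhds (fun n => ?_)
      fun n => pow_le_one₀ (hpmem n).1.le (hpmem n).2.le
    have hb := one_add_mul_le_pow (a := p n - 1) (by linarith [(hpmem n).1]) n
    rw [add_sub_cancel] at hb
    refine le_trans ?_ hb
    have h2 : n * (1 - p n) ≤ 1 / t * (1 / ((n : ℝ) + 1)) := by
      calc n * (1 - p n) ≤ ((n : ℝ) + 1) * (1 / t * (1 / ((n : ℝ) + 1) ^ 2)) := by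
            refine mul_le_mul (by linarith) (hle n) (by linarith [(hpmem n).2]) (by positivity)
        _ = 1 / t * (1 / ((n : ℝ) + 1)) := by field_simp
    simp only
    linarith
  have hrpow : Tendsto (fun n : ℕ => ((1 - p n) / 2) ^ (1 / ((n : ℝ) + 1))) atTop (𝓝 1) := by
    have hc : 0 < (1 - t) / 2 := half_pos h1t
    have h1 : Tendsto (fun n : ℕ => ((1 - t) / 2) ^ (1 / ((n : ℝ) + 1))) atTop (𝓝 1) := by
      have := (Real.continuousAt_const_rpow (b := 0) hc.ne').tendsto.comp
        (tendsto_one_div_add_atTop_nhds_zero_nat (𝕜 := ℝ))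
      rwa [Real.rpow_zero] at this
    have h2 : Tendsto (fun n : ℕ => ((((n : ℝ) + 1) ^ (1 / ((n : ℝ) + 1))) ^ 2)⁻¹) atTop (𝓝 1) := by
      have := (tendsto_rpow_div.comp
        (tendsto_natCast_atTop_atTop.atTop_add (tendsto_const_nhds (x := (1 : ℝ))))).pow 2 |>.inv₀
          (by norm_num)
      simpa using this
    have hlow := h1.mul h2
    rw [mul_one] at hlow
    refine tendsto_of_tendsto_of_tendsto_of_le_of_le hlow tendsto_const_nhds (fun n => ?_)
      fun n => Real.rpow_le_one (by linarith [(hpmem n).2]) (by linarith [(hpmem n).1])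
        (by positivity)
    have hn : (0 : ℝ) < (n : ℝ) + 1 := by positivity
    have h3 : ((((n : ℝ) + 1) ^ (1 / ((n : ℝ) + 1))) ^ 2)⁻¹ =
        (1 / ((n : ℝ) + 1) ^ 2) ^ (1 / ((n : ℝ) + 1)) := by
      rw [one_div (((n : ℝ) + 1) ^ 2), Real.inv_rpow (by positivity), ← Real.rpow_natCast,
        ← Real.rpow_natCast, ← Real.rpow_mul hn.le, ← Real.rpow_mul hn.le, mul_comm]
    simp only
    rw [h3, ← Real.mul_rpow hc.le (by positivity)]
    refine Real.rpow_le_rpow (by positivity) ?_ (by positivity)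
    have := hge n
    linarith
  have h := hpow.mul hrpow
  rw [mul_one] at h
  have h' := (Complex.continuous_ofReal.tendsto 1).comp h
  rw [Complex.ofReal_one] at h'
  refine h'.congr fun n => ?_
  have h0 : 0 ≤ (1 - p n) / 2 := by linarith [(hpmem n).2]
  rw [phi_ofReal, peak, Function.comp_apply, Complex.ofReal_mul, Complex.ofReal_pow,
    Complex.ofReal_cpow h0]
  simp only [p]
  push_cast
  rfl

/-! ### The lower bound -/

instance : (𝓝[unitDisk] (1 : ℂ)).NeBot := by
  rw [← mem_closure_iff_nhdsWithin_neBot, closure_ball _ one_ne_zero]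
  simp

theorem limsup_le_ofReal {v : BoundaryWeight} {K : ℂ → ℂ → ℂ} {t τ : ℝ}
    (hfin : limsupRatio v t < ⊤) (hτ : 0 ≤ τ)
    (hlim : Tendsto (fun z => kernelT K t z) (𝓝[unitDisk] (1 : ℂ)) (𝓝 (τ : ℂ))) :
    limsup (fun z => ENNReal.ofReal (v z / v (phi t z) * ‖kernelT K t z‖)) (𝓝[unitDisk] (1 : ℂ)) ≤
      ENNReal.ofReal ((limsupRatio v t).toReal * τ) := by
  have h1 : limsup (fun z => ENNReal.ofReal ‖kernelT K t z‖) (𝓝[unitDisk] (1 : ℂ)) =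
      ENNReal.ofReal τ := by
    have := (ENNReal.continuous_ofReal.tendsto _).comp hlim.norm
    rw [Complex.norm_of_nonneg hτ] at this
    exact this.limsup_eq
  rw [ENNReal.ofReal_mul ENNReal.toReal_nonneg, ENNReal.ofReal_toReal hfin.ne, ← h1, limsupRatio]
  simp_rw [fun z => ENNReal.ofReal_mul' (p := v z / v (phi t z)) (norm_nonneg (kernelT K t z))]
  exact ENNReal.limsup_mul_le' (Or.inr (by rw [h1]; exact ENNReal.ofReal_ne_top))
    (Or.inl hfin.ne)

/-- Evaluating `(I - L) (g · peak n)` at `testRadius n`, where `L` is compact, and applying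
dominated convergence. -/
theorem limsupIntegral_le_essNorm {v : BoundaryWeight} {K : ℂ → ℂ → ℂ} {g : ℂ → ℂ}
    (hδ : ∫⁻ s in Ioo (0 : ℝ) 1, ‖HInf.delta v (s : ℂ)‖ₑ < ⊤) (hK : AdmissibleKernel K)
    {I : HInf v →L[ℂ] HInf v} (hI : IsIntegralOperator v K I) (hCUBH : CondCUBH v K)
    (hCUB2H : CondCUB2H v K) (hg : AdmissibleG v g) (hCEVH : CondCEVH v K g) :
    limsupIntegral v K ≤ ENNReal.ofReal (essNorm (I.comp (HZero v).subtypeL)) := by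
  obtain ⟨R₀, hR₀, hA⟩ := hCUBH
  have hB := hCUB2H R₀ hR₀
  obtain ⟨M, hM, hMf⟩ := HInf.exists_norm_apply_le v hR₀.2
  choose! hfin hlimg τ hτ0 hτ using hCEVH
  set r := testRadius with hr
  set ψ : ℝ → ℝ := fun t => (limsupRatio v t).toReal * τ t with hψ
  -- the phase of `g (r n)` is divided out, so that the integrand contains the quotient
  -- `g (φ_t r) / g r` whose limit is known; if `g (r n) = 0` then `θ n = 0`
  set θ : ℕ → ℂ := fun n => ‖g (r n)‖ / g (r n) * v (r n) with hθ
  set H : ℕ → ℝ → ℂ := fun n t => θ n * (hg.test n (phi t (r n)) * kernelT K t (r n)) with hH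
  have hθn : ∀ n, ‖θ n‖ ≤ v (r n) := fun n => by
    have hv := (v.pos _ (testRadius_mem_unitDisk n)).le
    rw [hθ, norm_mul, norm_div, Complex.norm_of_nonneg (norm_nonneg _), Complex.norm_of_nonneg hv]
    exact mul_le_of_le_one_left hv (div_self_le_one _)
  have hmeas : ∀ n, AEStronglyMeasurable (H n) (volume.restrict (Ioo (0 : ℝ) 1)) := fun n => by
    have hz := testRadius_mem_unitDisk n
    refine ContinuousOn.aestronglyMeasurable ?_ measurableSet_Ioo
    exact continuousOn_const.mul (((hg.test n).differentiableOn.continuousOn.comp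
      ((continuousOn_phi hz).mono Ioo_subset_Icc_self) fun t ht => phi_mem_unitDisk ht hz).mul
      (hK.continuousOn_kernelT hz))
  have hbound : ∀ n, ∀ᵐ t ∂(volume.restrict (Ioo (0 : ℝ) 1)), ‖H n t‖ₑ ≤
      ENNReal.ofReal 1 * outerSup v K R₀ t + ENNReal.ofReal M * innerSup v K R₀ t := fun n => by
    filter_upwards [ae_restrict_mem measurableSet_Ioo] with t ht
    refine le_trans ?_ (enorm_apply_phi_mul_kernelT_le ht (testRadius_mem_unitDisk n)
      (h := hg.test n) zero_le_one hM.le (HInf.norm_le_iff.1 (hg.norm_test_le n)) fun w hw =>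
        (hMf _ w hw).trans (mul_le_of_le_one_right hM.le (hg.norm_test_le n)))
    rw [hH, enorm_mul, mul_comm, ← ofReal_norm (θ n)]
    gcongr
    exact hθn n
  have hbfin : ∫⁻ t in Ioo (0 : ℝ) 1, (ENNReal.ofReal 1 * outerSup v K R₀ t +
      ENNReal.ofReal M * innerSup v K R₀ t) ≠ ⊤ := by
    rw [lintegral_add_left' ((aemeasurable_outerSup hK R₀).const_mul _),
      lintegral_const_mul' _ _ ENNReal.ofReal_ne_top,
      lintegral_const_mul' _ _ ENNReal.ofReal_ne_top]
    exact ENNReal.add_ne_top.2 ⟨ENNReal.mul_ne_top ENNReal.ofReal_ne_top hA.ne,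
      ENNReal.mul_ne_top ENNReal.ofReal_ne_top hB.ne⟩
  have hlim : ∀ᵐ t ∂(volume.restrict (Ioo (0 : ℝ) 1)),
      Tendsto (fun n => H n t) atTop (𝓝 (ψ t : ℂ)) := by
    filter_upwards [ae_restrict_mem measurableSet_Ioo] with t ht
    have h1 := (hlimg t ht).comp tendsto_testRadius
    have h2 := (Complex.continuous_ofReal.tendsto 1).comp (hg.tendsto_one.comp tendsto_testRadius)
    have h3 := tendsto_peak_phi_testRadius ht
    have h4 := (hτ t ht).comp tendsto_testRadius_complex
    have h := ((h1.mul h2).mul h3).mul h4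
    rw [Complex.ofReal_one, mul_one, mul_one, ← Complex.ofReal_mul] at h
    refine h.congr fun n => ?_
    simp only [hH, hθ, Function.comp_apply, Complex.ofReal_mul]
    rw [hg.test_apply n (phi_mem_unitDisk ht (testRadius_mem_unitDisk n))]
    ring
  have hint : Integrable ψ (volume.restrict (Ioo (0 : ℝ) 1)) :=
    (integrable_of_tendsto_of_enorm_le hmeas hbound hbfin hlim).re
  have hconv := tendsto_integral_of_enorm_le hmeas hbound hbfin hlim
  have hψ0 : 0 ≤ᵐ[volume.restrict (Ioo (0 : ℝ) 1)] ψ := by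
    filter_upwards [ae_restrict_mem measurableSet_Ioo] with t ht
    exact mul_nonneg ENNReal.toReal_nonneg (hτ0 t ht)
  calc limsupIntegral v K ≤ ∫⁻ t in Ioo (0 : ℝ) 1, ENNReal.ofReal (ψ t) :=
        setLIntegral_mono' measurableSet_Ioo fun t ht =>
          limsup_le_ofReal (hfin t ht) (hτ0 t ht) (hτ t ht)
    _ = ENNReal.ofReal (∫ t in Ioo (0 : ℝ) 1, ψ t) :=
        (ofReal_integral_eq_lintegral_ofReal hint hψ0).symm
    _ ≤ _ := ENNReal.ofReal_le_ofReal (le_essNorm fun L hL => ?_)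
  set f : ℕ → HZero v := fun n => ⟨hg.test n, hg.test_mem_hZero n⟩ with hf
  have hf1 : ∀ n, ‖f n‖ ≤ 1 := hg.norm_test_le
  have hLf := (hL.tendsto_zero_of_locally_null hf1 fun R hR ε hε =>
    hg.test_locally_null hR hε).norm
  set D := I.comp (HZero v).subtypeL - L with hD
  have hkey : ∀ n, ‖∫ t in Ioo (0 : ℝ) 1, H n t‖ ≤ ‖D‖ + ‖L (f n)‖ := fun n => by
    have hz := testRadius_mem_unitDisk n
    have h1 : ∫ t in Ioo (0 : ℝ) 1, H n t = θ n * I (hg.test n) (r n) := by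
      rw [hI.apply_eq hδ hK _ hz, ← integral_const_mul]
    have h2 : I (hg.test n) = D (f n) + L (f n) := by
      rw [hD, _root_.sub_apply, sub_add_cancel]
      rfl
    rw [h1, norm_mul, mul_comm]
    calc ‖I (hg.test n) (r n)‖ * ‖θ n‖ ≤ ‖I (hg.test n) (r n)‖ * v (r n) := by
          gcongr
          exact hθn n
      _ ≤ ‖I (hg.test n)‖ := HInf.le_norm _ hz
      _ ≤ ‖D (f n)‖ + ‖L (f n)‖ := by rw [h2]; exact norm_add_le _ _
      _ ≤ ‖D‖ + ‖L (f n)‖ := by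
          gcongr
          exact (D.le_opNorm _).trans (mul_le_of_le_one_right (norm_nonneg D) (hf1 n))
  have hfinal := le_of_tendsto_of_tendsto' hconv.norm (hLf.const_add ‖D‖) hkey
  rw [norm_zero, add_zero, integral_complex_ofReal, Complex.norm_real] at hfinal
  exact (Real.le_norm_self _).trans hfinal

theorem mainTheorem3 (v : BoundaryWeight) (K : ℂ → ℂ → ℂ) (g : ℂ → ℂ)
    (hδ : ∫⁻ s in Set.Ioo (0 : ℝ) 1, ‖HInf.delta v (s : ℂ)‖ₑ < ⊤)
    (hK : AdmissibleKernel K)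
    (I : HInf v →L[ℂ] HInf v) (hI : IsIntegralOperator v K I)
    (hCUBH : CondCUBH v K) (hCUB2H : CondCUB2H v K)
    (hg : AdmissibleG v g) (hCEVH : CondCEVH v K g) :
    ENNReal.ofReal (essNorm I) = limsupIntegral v K ∧
    ENNReal.ofReal (essNorm (I.comp (HZero v).subtypeL)) = limsupIntegral v K := by
  have hup := essNorm_le_limsupIntegral hδ hK hI hCUBH hCUB2H
  have hlow := limsupIntegral_le_essNorm hδ hK hI hCUBH hCUB2H hg hCEVH
  have hmid := ENNReal.ofReal_le_ofReal (essNorm_comp_subtypeL_le I (HZero v))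
  exact ⟨le_antisymm hup (hlow.trans hmid), le_antisymm (hmid.trans hup) hlow⟩
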